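/- Consider the linear system $X(t+1)=AX(t)+V(t)\in\mathbb R^{n_x}$, $Y(t)=CX(t)+W(t)\in\mathbb R^{n_y}$, $t\in\mathbb N_0$, where $(C,A)$ is observable and $A$ has at least one eigenvalue of modulus greater than one. The disturbance signals $V=(V(t))_t$ and $W=(W(t))_t$ take values in given sets of sequences (their ranges), each of which is uniformly bounded (over all its members and all times) and contains the zero sequence; let $h_{lin}=\sum_{|\lambda_i|\ge 1}\log_q|\lambda_i|$, the sum being over the eigenvalues of $A$ counted with multiplicity. Let $\mathcal X$ be a finite commutative group (for example $\mathbb Z/q$) with $q=|\mathcal X|\ge 2$ elements and operation $\oplus$. A finite-state additive noise channel maps an input sequence $D(t)\in\mathcal X$ to $Q(t)=D(t)\oplus Z(t)$, where $Z$ is the sequence of edge labels along an arbitrary infinite walk, from an arbitrary unknown initial state, in a finite nonempty directed graph with at most one edge for each ordered pair of vertices (every two vertices, including equal ones, being joined by a walk of positive length) whose edges are labelled by elements of $\mathcal X$, with distinct labels on distinct edges leaving the same vertex. Let $h_{ch}=\log_q\lambda$, where $\lambda$ is the Perron eigenvalue (spectral radius) of the $0/1$ adjacency matrix of the graph. The initial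 state $X(0)$, the signals $V$ and $W$, and the channel noise $Z$ are mutually unrelated: all combinations of their possible realizations can occur. A coder-estimator consists of maps $D(t)=\zeta(t,Y(0),\dots,Y(t))\in\mathcal X$ and $\hat X(t+1)=\eta(t,Q(0),\dots,Q(t))\in\mathbb R^{n_x}$, with $\hat X(0)=0$. It yields uniformly bounded estimation errors if for all such ranges of $V$ and $W$ there is $l>0$ such that, for every range of $X(0)$ contained in $\{x:\|x\|\le l\}$, $\sup\|X(t)-\hat X(t)\|<\infty$, the supremum being over all $t$ and all realizations of $X(0)$, $V$, $W$, $Z$. (i) If $h_{lin}+2h_{ch}<1$, then there is a coder-estimator that yields uniformly bounded estimation errors. (ii) If $h_{lin}+h_{ch}>1$, then for every coder-estimator, all such ranges of $V$ and $W$, and every $l>0$, there are disturbance sequences $v$ and $w$ in these ranges, an initial state $x_0$ with $\|x_0\|\le l$ and a channel noise sequence $z$ for which the estimation error is unbounded: $\sup_t\|X(t)-\hat X(t)\|=\infty$. -/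

import Mathlib

noncomputable section

namespace FSEstimation

/-! ### The linear system -/

/-- The matrices of the system `X (t+1) = A X t + V t`, `Y t = C X t + W t`,
with state space `ℝ^nx` and output space `ℝ^ny`.  Only boundedness of norms matters below, so the
norm on `ℝ^n` (here the maximum norm of `Fin n → ℝ`) can be replaced by any other one. -/
structure LTISystem (nx ny : ℕ) where
  A : Matrix (Fin nx) (Fin nx) ℝ
  C : Matrix (Fin ny) (Fin nx) ℝ

namespace LTISystem

variable {nx ny : ℕ} (P : LTISystem nx ny)

/-- Observability of `(C, A)`: the undisturbed outputs `C A^k x` determine the initial state. -/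
def Observable : Prop :=
  ∀ x : Fin nx → ℝ, (∀ k : ℕ, P.C.mulVec ((P.A ^ k).mulVec x) = 0) → x = 0

/-- The complex eigenvalues of `A`, with algebraic multiplicity. -/
def eigenvalues : Multiset ℂ := (P.A.map ((↑) : ℝ → ℂ)).charpoly.roots

/-- `A` has an eigenvalue of modulus greater than one. -/
def HasUnstableEigenvalue : Prop := ∃ μ ∈ P.eigenvalues, 1 < ‖μ‖

open Classical in
/-- Topological entropy of the linear system in base `q`: the sum of `log_q |μ|` over the
eigenvalues `μ` with `|μ| ≥ 1`, with multiplicity. -/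
def entropy (q : ℕ) : ℝ :=
  ((P.eigenvalues.filter (fun μ => 1 ≤ ‖μ‖)).map (fun μ => Real.logb q ‖μ‖)).sum

/-- State trajectory for initial state `x₀` and process disturbance `v`. -/
def state (x₀ : Fin nx → ℝ) (v : ℕ → Fin nx → ℝ) : ℕ → Fin nx → ℝ
  | 0 => x₀
  | t + 1 => P.A.mulVec (state x₀ v t) + v t

/-- Measured output for initial state `x₀`, process disturbance `v`, measurement disturbance `w`. -/
def output (x₀ : Fin nx → ℝ) (v : ℕ → Fin nx → ℝ) (w : ℕ → Fin ny → ℝ) (t : ℕ) : Fin ny → ℝ :=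
  P.C.mulVec (P.state x₀ v t) + w t

end LTISystem

/-- Admissible range (set of possible realizations) of a disturbance signal: it is uniformly
bounded over all realizations and all times, and contains the zero signal. -/
def AdmissibleRange {n : ℕ} (R : Set (ℕ → Fin n → ℝ)) : Prop :=
  0 ∈ R ∧ ∃ b : ℝ, ∀ v ∈ R, ∀ t, ‖v t‖ ≤ b

/-! ### The channel -/

/-- A finite-state additive noise channel with state set `S` and alphabet `X`.  The noise is
governed by a strongly connected directed graph on `S`; the edge `s → s'` carries the noise value
`label s s'`, and distinct edges leaving the same state carry distinct values.  (`TransGen` asks for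
walks of positive length: a one-state graph must have its loop, otherwise no noise sequence exists.)
The value of `label` at a non-edge is irrelevant. -/
structure AdditiveNoiseChannel (S X : Type*) where
  Edge : S → S → Prop
  label : S → S → X
  label_injective : ∀ s s₁ s₂, Edge s s₁ → Edge s s₂ → label s s₁ = label s s₂ → s₁ = s₂
  strongly_connected : ∀ s s', Relation.TransGen Edge s s'

namespace AdditiveNoiseChannel

variable {S X : Type*} (K : AdditiveNoiseChannel S X)

open Classical in
/-- Adjacency matrix of the state transition graph. -/
def adjacency : Matrix S S ℂ := Matrix.of fun s s' => if K.Edge s s' then 1 else 0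

/-- The Perron eigenvalue of the adjacency matrix: its largest eigenvalue in modulus. -/
def perronEigenvalue [Fintype S] [DecidableEq S] : ℝ := (spectralRadius ℂ K.adjacency).toReal

/-- Topological entropy of the channel, in base `q = |X|`. -/
def entropy [Fintype S] [DecidableEq S] [Fintype X] : ℝ :=
  Real.logb (Fintype.card X) K.perronEigenvalue

/-- `z` is a noise sequence of the channel: the labels along an infinite walk from some state. -/
def IsNoise (z : ℕ → X) : Prop :=
  ∃ s : ℕ → S, ∀ t, K.Edge (s t) (s (t + 1)) ∧ z t = K.label (s t) (s (t + 1))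

end AdditiveNoiseChannel

/-! ### Coding and estimation over the channel -/

/-- A causal coder `D t = ζ (t, Y (0:t))` and a causal estimator `X̂ (t+1) = η (t, Q (0:t))`. -/
structure CoderEstimator (nx ny : ℕ) (X : Type*) where
  coder : (t : ℕ) → (Fin (t + 1) → Fin ny → ℝ) → X
  estimator : (t : ℕ) → (Fin (t + 1) → X) → Fin nx → ℝ

namespace CoderEstimator

variable {nx ny : ℕ} {X : Type*} (F : CoderEstimator nx ny X)

/-- Channel input when the plant output is `y`. -/
def channelInput (y : ℕ → Fin ny → ℝ) (t : ℕ) : X := F.coder t (fun i => y i)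

/-- Channel output when the plant output is `y` and the channel noise is `z`. -/
def channelOutput [Add X] (y : ℕ → Fin ny → ℝ) (z : ℕ → X) (t : ℕ) : X :=
  F.channelInput y t + z t

/-- State estimate computed from the received sequence `r`, with `X̂ 0 = 0`. -/
def estimate (r : ℕ → X) : ℕ → Fin nx → ℝ
  | 0 => 0
  | t + 1 => F.estimator t (fun i => r i)

/-- Estimation error `X t - X̂ t` for initial state `x₀`, process disturbance `v`, measurement
disturbance `w` and channel noise `z`. -/
def error [Add X] (P : LTISystem nx ny) (x₀ : Fin nx → ℝ) (v : ℕ → Fin nx → ℝ)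
    (w : ℕ → Fin ny → ℝ) (z : ℕ → X) (t : ℕ) : Fin nx → ℝ :=
  P.state x₀ v t - F.estimate (F.channelOutput (P.output x₀ v w) z) t

/-- Uniformly bounded estimation errors: for all admissible disturbance ranges there is `l > 0` such
that for every range of the initial state in the `l`-ball the error is bounded over all times and
realizations.  Initial state, disturbances and channel noise are mutually unrelated, that is, every
combination of realizations from their ranges can occur. -/
def UniformlyBounded {S : Type*} [Add X] (P : LTISystem nx ny) (K : AdditiveNoiseChannel S X) :
    Prop :=
  ∀ (𝒱 : Set (ℕ → Fin nx → ℝ)) (𝒲 : Set (ℕ → Fin ny → ℝ)),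
    AdmissibleRange 𝒱 → AdmissibleRange 𝒲 →
    ∃ l : ℝ, 0 < l ∧ ∀ R₀ : Set (Fin nx → ℝ), R₀ ⊆ Metric.closedBall 0 l →
      ∃ M : ℝ, ∀ x₀ ∈ R₀, ∀ v ∈ 𝒱, ∀ w ∈ 𝒲, ∀ z : ℕ → X, K.IsNoise z →
        ∀ t, ‖F.error P x₀ v w z t‖ ≤ M

end CoderEstimator

end FSEstimation

end

/-!
The volume of `A ^ k B` grows like the `k`-th power of the product `unstableDet A` of the unstable
eigenvalue moduli, once the stable part, split off by a spectral idempotent, is discarded; hence it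
takes about `unstableDet A ^ k` points to resolve `A ^ k B` up to a bounded error. The noise words
of length `k` number about `λ ^ k` with `λ` the Perron eigenvalue.

For a rate below capacity, a greedy (Gilbert–Varshamov) choice gives a zero-error block code: two
codewords conflict when they differ by two noise words, so each excludes at most `(λ ^ k) ^ 2`
others, whence the factor `2` in front of the channel entropy. The coder sends quantized prediction
errors with this code; as it does not know the size of the disturbances, it enlarges its scale
whenever the error overflows, which happens only finitely often.

For the converse, take the disturbances zero. Were all errors bounded, Baire's theorem on the
compact space of walks would give one initial walk segment and a set of initial states of positive
measure on which a common bound holds for all continuations of the segment. The received word then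
determines the state at time `T` up to a bounded error, and with the coder's input also the noise
word. So about `unstableDet A ^ T` separated initial states and `λ ^ T` noise words give different
ones of the `q ^ T` received words, and `unstableDet A * λ ≤ q`.
-/

noncomputable section

namespace FSEstimation

open Filter Topology MeasureTheory
open scoped Matrix Matrix.Norms.Operator ENNReal NNReal

section Polynomials

open Polynomial

variable {K L : Type*} [Field K] [Field L] [Algebra K L]

theorem isConjRoot_of_irreducible_of_aeval_eq_zero {p : K[X]} (hp : Irreducible p) {x y : L}
    (hx : aeval x p = 0) (hy : aeval y p = 0) : IsConjRoot K x y := by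
  rw [IsConjRoot, ← minpoly.eq_of_irreducible hp hx, minpoly.eq_of_irreducible hp hy]

theorem exists_mul_eq_of_isConjRoot_invariant {Q : L → Prop}
    (hQ : ∀ x y, IsConjRoot K x y → Q x → Q y) {p : K[X]} (hp : p ≠ 0) :
    ∃ u s : K[X], u * s = p ∧ (∀ x : L, aeval x u = 0 → Q x) ∧ ∀ x : L, aeval x s = 0 → ¬ Q x := by
  induction p using WfDvdMonoid.induction_on_irreducible with
  | zero => exact absurd rfl hp
  | unit v hv =>
    refine ⟨v, 1, mul_one v, fun x hx => ?_, fun x hx => by simp at hx⟩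
    exact absurd (hx ▸ hv.map (aeval x)) not_isUnit_zero
  | mul a i ha hi ih =>
    obtain ⟨u, s, rfl, hu, hs⟩ := ih ha
    by_cases hroot : ∃ x : L, aeval x i = 0 ∧ Q x
    · obtain ⟨x, hx, hQx⟩ := hroot
      refine ⟨i * u, s, mul_assoc _ _ _, fun y hy => ?_, hs⟩
      rcases mul_eq_zero.mp ((map_mul (aeval y) i u).symm.trans hy) with hy | hy
      · exact hQ x y (isConjRoot_of_irreducible_of_aeval_eq_zero hi hx hy) hQx
      · exact hu y hy
    · refine ⟨u, i * s, mul_left_comm _ _ _, hu, fun y hy => ?_⟩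
      rcases mul_eq_zero.mp ((map_mul (aeval y) i s).symm.trans hy) with hy | hy
      · exact fun hQy => hroot ⟨y, hy, hQy⟩
      · exact hs y hy

open Classical in
theorem exists_aeval_eq_indicator [IsAlgClosed L] {Q : L → Prop}
    (hQ : ∀ x y, IsConjRoot K x y → Q x → Q y) {p : K[X]} (hp : p ≠ 0) :
    ∃ e : K[X], p ∣ e * (1 - e) ∧ ∀ x : L, aeval x p = 0 → aeval x e = if Q x then 1 else 0 := by
  obtain ⟨u, s, rfl, hu, hs⟩ := exists_mul_eq_of_isConjRoot_invariant hQ hp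
  obtain ⟨a, b, hab⟩ : IsCoprime u s := by
    refine (isCoprime_iff_aeval_ne_zero_of_isAlgClosed K L u s).mpr fun x => ?_
    by_contra! h
    exact hs x h.2 (hu x h.1)
  refine ⟨b * s, ⟨a * b, ?_⟩, fun x hx => ?_⟩
  · rw [← hab]
    ring
  · rcases mul_eq_zero.mp ((map_mul (aeval x) u s).symm.trans hx) with h | h
    · have hbs : b * s = 1 - a * u := by rw [← hab, add_sub_cancel_left]
      simp [hu x h, hbs, h]
    · simp [hs x h, h]

theorem norm_eq_of_isConjRoot {z w : ℂ} (h : IsConjRoot ℝ z w) : ‖z‖ = ‖w‖ := by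
  have : IsAlgClosure ℝ ℂ := ⟨inferInstance, inferInstance⟩
  have : Normal ℝ ℂ := IsAlgClosure.normal ℝ ℂ
  obtain ⟨σ, rfl⟩ := h.exists_algEquiv
  rcases Complex.real_algHom_eq_id_or_conj σ.toAlgHom with hσ | hσ
  · simpa using congrArg norm (DFunLike.congr_fun hσ w)
  · simpa using congrArg norm (DFunLike.congr_fun hσ w)

end Polynomials

section Eigenvalues

open Polynomial

variable {n : Type*} [Fintype n] [DecidableEq n]

theorem det_aeval_eq_prod_roots_charpoly {K : Type*} [Field K] [IsAlgClosed K]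
    (M : Matrix n n K) (f : K[X]) :
    (aeval M f).det = (M.charpoly.roots.map fun z => f.eval z).prod := by
  have hcard : M.charpoly.roots.card = Fintype.card n := by
    rw [← (IsAlgClosed.splits M.charpoly).natDegree_eq_card_roots, M.charpoly_natDegree_eq_dim]
  have hlinear : ∀ c, (aeval M (X - C c)).det = (M.charpoly.roots.map fun z => z - c).prod := by
    intro c
    have hneg : aeval M (X - C c) = -(Matrix.scalar n c - M) := by
      simp [Algebra.algebraMap_eq_smul_one, Matrix.smul_one_eq_diagonal]
    rw [hneg, Matrix.det_neg, ← Matrix.eval_charpoly,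
      (IsAlgClosed.splits M.charpoly).eval_eq_prod_roots, M.charpoly_monic.leadingCoeff, one_mul,
      ← hcard, ← Multiset.card_map (fun z => c - z), ← Multiset.prod_map_neg, Multiset.map_map]
    simp
  calc (aeval M f).det
      = f.leadingCoeff ^ Fintype.card n * (f.roots.map fun c => (aeval M (X - C c)).det).prod := by
        conv_lhs => rw [(IsAlgClosed.splits f).eq_prod_roots, map_mul, Matrix.det_mul]
        congr 1
        · simp [Algebra.algebraMap_eq_smul_one]
        · let φ := Matrix.detMonoidHom.comp (aeval M : K[X] →ₐ[K] Matrix n n K).toMonoidHom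
          exact (map_multiset_prod φ _).trans (by rw [Multiset.map_map]; rfl)
    _ = (M.charpoly.roots.map fun z =>
          f.leadingCoeff * (f.roots.map fun c => z - c).prod).prod := by
        rw [Multiset.prod_map_mul, Multiset.map_const', Multiset.prod_replicate, hcard,
          Multiset.prod_map_prod_map]
        simp only [hlinear]
    _ = _ := by simp only [(IsAlgClosed.splits f).eval_eq_prod_roots]

theorem roots_charpoly_aeval {K : Type*} [Field K] [IsAlgClosed K] (M : Matrix n n K) (f : K[X]) :
    (aeval M f).charpoly.roots = M.charpoly.roots.map fun z => f.eval z := by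
  suffices h : (aeval M f).charpoly =
      ((M.charpoly.roots.map fun z => f.eval z).map fun z => X - C z).prod by
    rw [h, roots_multiset_prod_X_sub_C]
  have := IsAlgClosed.instInfinite (K := K)
  refine Polynomial.funext fun c => ?_
  have hsub : Matrix.scalar n c - aeval M f = aeval M (C c - f) := by
    simp [Algebra.algebraMap_eq_smul_one, Matrix.smul_one_eq_diagonal]
  rw [Matrix.eval_charpoly, hsub, det_aeval_eq_prod_roots_charpoly, eval_multiset_prod,
    Multiset.map_map, Multiset.map_map]
  simp

/-- The complex eigenvalues of a real matrix, with algebraic multiplicity. -/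
def complexEigenvalues (A : Matrix n n ℝ) : Multiset ℂ :=
  (A.map ((↑) : ℝ → ℂ)).charpoly.roots

theorem complexEigenvalues_aeval (A : Matrix n n ℝ) (f : ℝ[X]) :
    complexEigenvalues (aeval A f) = (complexEigenvalues A).map fun z => aeval z f := by
  have hmap : (aeval A f).map ((↑) : ℝ → ℂ) =
      aeval (A.map ((↑) : ℝ → ℂ)) (f.map (algebraMap ℝ ℂ)) := by
    refine map_aeval_eq_aeval_map (U := Matrix n n ℂ) (ψ := Complex.ofRealHom.mapMatrix) ?_ f A
    ext r i j
    by_cases hij : i = j <;> simp [Algebra.algebraMap_eq_smul_one, hij]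
  rw [complexEigenvalues, hmap, roots_charpoly_aeval]
  simp only [eval_map_algebraMap, complexEigenvalues]

theorem mem_complexEigenvalues {A : Matrix n n ℝ} {z : ℂ} :
    z ∈ complexEigenvalues A ↔ z ∈ spectrum ℂ (A.map ((↑) : ℝ → ℂ)) := by
  rw [Matrix.mem_spectrum_iff_isRoot_charpoly, complexEigenvalues,
    mem_roots (Matrix.charpoly_monic _).ne_zero]

theorem aeval_charpoly_eq_zero_of_mem {A : Matrix n n ℝ} {z : ℂ} (hz : z ∈ complexEigenvalues A) :
    aeval z A.charpoly = 0 := by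
  have hcharpoly : (A.map ((↑) : ℝ → ℂ)).charpoly = A.charpoly.map (algebraMap ℝ ℂ) :=
    Matrix.charpoly_map A Complex.ofRealHom
  have hroot := (mem_roots'.mp hz).2
  rwa [hcharpoly, IsRoot, eval_map_algebraMap] at hroot

theorem abs_det_eq_prod_norm (A : Matrix n n ℝ) :
    |A.det| = ((complexEigenvalues A).map fun z => ‖z‖).prod := by
  have hdet : ((A.det : ℝ) : ℂ) = (complexEigenvalues A).prod :=
    (Complex.ofRealHom.map_det A).trans (Matrix.det_eq_prod_roots_charpoly _)
  rw [← Real.norm_eq_abs, ← Complex.norm_real, hdet]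
  exact map_multiset_prod (normHom : ℂ →*₀ ℝ) _

theorem norm_le_one_of_mem_complexEigenvalues_inv {H : Matrix n n ℝ}
    (hH : ∀ z ∈ complexEigenvalues H, 1 ≤ ‖z‖) : ∀ z ∈ complexEigenvalues H⁻¹, ‖z‖ ≤ 1 := by
  have hunit : IsUnit H := by
    rw [Matrix.isUnit_iff_isUnit_det, isUnit_iff_ne_zero, ← abs_pos, abs_det_eq_prod_norm]
    exact one_pos.trans_le <| Multiset.one_le_prod fun _ h => by
      obtain ⟨z, hz, rfl⟩ := Multiset.mem_map.mp h
      exact hH z hz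
  obtain ⟨v, rfl⟩ := hunit
  intro z hz
  let w : (Matrix n n ℂ)ˣ := Units.map (Complex.ofRealHom.mapMatrix (m := n)).toMonoidHom v
  have hz' : z ∈ spectrum ℂ ((w⁻¹ : (Matrix n n ℂ)ˣ) : Matrix n n ℂ) := by
    rwa [← Matrix.coe_units_inv, mem_complexEigenvalues] at hz
  have hz0 : z ≠ 0 := spectrum.ne_zero_of_mem_of_unit hz'
  have hinv : z⁻¹ ∈ spectrum ℂ (w : Matrix n n ℂ) := by
    simpa using (spectrum.inv_mem_iff (r := Units.mk0 z hz0) (a := w⁻¹)).mp hz'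
  have hone := hH z⁻¹ (mem_complexEigenvalues.mpr hinv)
  rw [norm_inv] at hone
  exact (one_le_inv₀ (norm_pos_iff.mpr hz0)).mp hone

end Eigenvalues

section PowerGrowth

theorem exists_norm_pow_le_of_spectralRadius_lt {R : Type*} [NormedRing R] [NormedAlgebra ℂ R]
    [CompleteSpace R] {a : R} {θ : ℝ} (hθ : spectralRadius ℂ a < ENNReal.ofReal θ) :
    ∃ c : ℝ, 0 < c ∧ ∀ k : ℕ, ‖a ^ k‖ ≤ c * θ ^ k := by
  have hθ0 : 0 < θ := ENNReal.ofReal_pos.mp (bot_le.trans_lt hθ)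
  have hgelfand := spectrum.pow_norm_pow_one_div_tendsto_nhds_spectralRadius a
  have hev : ∀ᶠ k : ℕ in atTop, ‖a ^ k‖ / θ ^ k ≤ 1 := by
    filter_upwards [hgelfand.eventually_lt_const hθ, eventually_ne_atTop 0] with k hk hk0
    have hroot := pow_le_pow_left₀ (by positivity) ((ENNReal.ofReal_lt_ofReal_iff hθ0).mp hk).le k
    rw [one_div, Real.rpow_inv_natCast_pow (norm_nonneg _) hk0] at hroot
    exact div_le_one_of_le₀ hroot (by positivity)
  obtain ⟨c, hc⟩ := (isBoundedUnder_of_eventually_le hev).bddAbove_range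
  refine ⟨max c 1, by positivity, fun k => ?_⟩
  rw [← div_le_iff₀ (by positivity)]
  exact (hc ⟨k, rfl⟩).trans (le_max_left c 1)

variable {n : Type*} [Fintype n] [DecidableEq n]

theorem exists_norm_pow_le_of_norm_complexEigenvalues_le_one {M : Matrix n n ℝ}
    (hM : ∀ z ∈ complexEigenvalues M, ‖z‖ ≤ 1) {θ : ℝ} (hθ : 1 < θ) :
    ∃ c : ℝ, 0 < c ∧ ∀ k : ℕ, ‖M ^ k‖ ≤ c * θ ^ k := by
  have hradius : spectralRadius ℂ (M.map ((↑) : ℝ → ℂ)) ≤ 1 :=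
    iSup₂_le fun z hz => by exact_mod_cast hM z (mem_complexEigenvalues.mpr hz)
  obtain ⟨c, hc, hpow⟩ := exists_norm_pow_le_of_spectralRadius_lt
    (hradius.trans_lt (ENNReal.one_lt_ofReal.mpr hθ))
  refine ⟨c, hc, fun k => ?_⟩
  have hmap : (M.map ((↑) : ℝ → ℂ)) ^ k = (M ^ k).map ((↑) : ℝ → ℂ) :=
    ((Complex.ofRealHom.mapMatrix (m := n)).map_pow M k).symm
  simpa [hmap, Matrix.linfty_opNorm_def] using hpow k

end PowerGrowth

section Idempotent

variable {R : Type*} [Ring R] {a e : R}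

theorem commute_one_sub (hae : Commute a e) : Commute a (1 - e) :=
  (Commute.one_right a).sub_right hae

theorem pow_mul_of_isIdempotentElem (he : IsIdempotentElem e) (hae : Commute a e) (k : ℕ) :
    (a * e) ^ k * e = a ^ k * e := by
  rw [hae.mul_pow, mul_assoc, ← pow_succ, he.pow_succ_eq]

theorem mul_add_one_sub_pow (he : IsIdempotentElem e) (hae : Commute a e) (k : ℕ) :
    (a * e + (1 - e)) ^ k = a ^ k * e + (1 - e) := by
  induction k with
  | zero => simp
  | succ k ih =>
    have hcross : a ^ k * e * (1 - e) = 0 := by rw [mul_assoc, he.mul_one_sub_self, mul_zero]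
    have hcross' : (1 - e) * (a * e) = 0 := by
      rw [hae.eq, ← mul_assoc, he.one_sub_mul_self, zero_mul]
    rw [pow_succ, ih, add_mul, mul_add, mul_add, hcross, hcross', he.one_sub.eq, add_zero, zero_add,
      mul_assoc, ← mul_assoc e, ← hae.eq, mul_assoc a, he.eq, ← mul_assoc, ← pow_succ]

end Idempotent

section UnstablePart

open Polynomial

variable {n : Type*} [Fintype n] [DecidableEq n]

/-- The product of the moduli of the eigenvalues outside the unit disc: the factor by which `A`
expands volumes along its unstable subspace. -/
def unstableDet (A : Matrix n n ℝ) : ℝ :=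
  ((complexEigenvalues A).map fun z => max 1 ‖z‖).prod

theorem one_le_unstableDet (A : Matrix n n ℝ) : 1 ≤ unstableDet A :=
  Multiset.one_le_prod fun _ h => by
    obtain ⟨z, -, rfl⟩ := Multiset.mem_map.mp h
    exact le_max_left 1 ‖z‖

theorem exists_unstable_idempotent (A : Matrix n n ℝ) :
    ∃ E : Matrix n n ℝ, IsIdempotentElem E ∧ Commute A E ∧
      complexEigenvalues (A * E + (1 - E)) =
        (complexEigenvalues A).map (fun z => if 1 ≤ ‖z‖ then z else 1) ∧
      complexEigenvalues (A * (1 - E)) =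
        (complexEigenvalues A).map fun z => if 1 ≤ ‖z‖ then 0 else z := by
  obtain ⟨e, hdvd, heval⟩ := exists_aeval_eq_indicator (K := ℝ) (Q := fun z : ℂ => 1 ≤ ‖z‖)
    (fun z w hzw hz => hz.trans_eq (norm_eq_of_isConjRoot hzw)) A.charpoly_monic.ne_zero
  have hzero : aeval A e * (1 - aeval A e) = 0 := by
    simpa using aeval_eq_zero_of_dvd_aeval_eq_zero hdvd A.aeval_self_charpoly
  refine ⟨aeval A e, ?_, ?_, ?_, ?_⟩
  · rwa [mul_sub, mul_one, sub_eq_zero, eq_comm] at hzero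
  · simpa using (Commute.all X e).map (aeval A : ℝ[X] →ₐ[ℝ] Matrix n n ℝ)
  · have hpoly : A * aeval A e + (1 - aeval A e) = aeval A (X * e + (1 - e)) := by simp
    rw [hpoly, complexEigenvalues_aeval]
    refine Multiset.map_congr rfl fun z hz => ?_
    split_ifs with h <;> simp [heval z (aeval_charpoly_eq_zero_of_mem hz), h]
  · have hpoly : A * (1 - aeval A e) = aeval A (X * (1 - e)) := by simp
    rw [hpoly, complexEigenvalues_aeval]
    refine Multiset.map_congr rfl fun z hz => ?_
    split_ifs with h <;> simp [heval z (aeval_charpoly_eq_zero_of_mem hz), h]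

theorem exists_unstable_idempotent_growth (A : Matrix n n ℝ) :
    ∃ E : Matrix n n ℝ, IsIdempotentElem E ∧ Commute A E ∧
      |(A * E + (1 - E)).det| = unstableDet A ∧
      (∀ θ : ℝ, 1 < θ → ∃ c : ℝ, 0 < c ∧ ∀ k : ℕ, ‖(A * E + (1 - E))⁻¹ ^ k‖ ≤ c * θ ^ k) ∧
      ∀ θ : ℝ, 1 < θ → ∃ c : ℝ, 0 < c ∧ ∀ k : ℕ, ‖(A * (1 - E)) ^ k‖ ≤ c * θ ^ k := by
  obtain ⟨E, hE, hAE, hunst, hstab⟩ := exists_unstable_idempotent A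
  refine ⟨E, hE, hAE, ?_, fun θ hθ => ?_, fun θ hθ => ?_⟩
  · rw [abs_det_eq_prod_norm, hunst, Multiset.map_map, unstableDet]
    refine congrArg _ (Multiset.map_congr rfl fun z _ => ?_)
    by_cases hz : 1 ≤ ‖z‖
    · simp [hz]
    · simp [hz, (not_le.mp hz).le]
  · refine exists_norm_pow_le_of_norm_complexEigenvalues_le_one
      (norm_le_one_of_mem_complexEigenvalues_inv fun z hz => ?_) hθ
    obtain ⟨w, -, rfl⟩ := Multiset.mem_map.mp (hunst ▸ hz)
    by_cases hw : 1 ≤ ‖w‖ <;> simp [hw]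
  · refine exists_norm_pow_le_of_norm_complexEigenvalues_le_one (fun z hz => ?_) hθ
    obtain ⟨w, -, rfl⟩ := Multiset.mem_map.mp (hstab ▸ hz)
    by_cases hw : 1 ≤ ‖w‖
    · simp [hw]
    · simp [hw, (not_le.mp hw).le]

theorem inv_pow_mul_pow_self {H : Matrix n n ℝ} (hH : H.det ≠ 0) (k : ℕ) :
    H⁻¹ ^ k * H ^ k = 1 := by
  have hunit : IsUnit H.det := isUnit_iff_ne_zero.mpr hH
  have hcomm : Commute H⁻¹ H :=
    (Matrix.nonsing_inv_mul H hunit).trans (Matrix.mul_nonsing_inv H hunit).symm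
  rw [← hcomm.mul_pow, Matrix.nonsing_inv_mul H hunit, one_pow]

theorem inv_pow_mul_pow_eq {A E : Matrix n n ℝ} (hE : IsIdempotentElem E) (hAE : Commute A E)
    (hdet : (A * E + (1 - E)).det ≠ 0) (k : ℕ) :
    (A * E + (1 - E))⁻¹ ^ k * A ^ k =
      E + (A * E + (1 - E))⁻¹ ^ k * (A * (1 - E)) ^ k * (1 - E) := by
  have hpow : (A * E + (1 - E)) ^ k * E = A ^ k * E := by
    rw [mul_add_one_sub_pow hE hAE, add_mul, hE.one_sub_mul_self, add_zero, mul_assoc, hE.eq]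
  have hsplit : A ^ k = (A * E + (1 - E)) ^ k * E + A ^ k * (1 - E) := by
    rw [hpow, ← mul_add, add_sub_cancel, mul_one]
  conv_lhs => rw [hsplit]
  rw [mul_add, ← mul_assoc, inv_pow_mul_pow_self hdet, one_mul, mul_assoc,
    pow_mul_of_isIdempotentElem hE.one_sub (commute_one_sub hAE)]

-- With `E` the unstable spectral idempotent of `A`, the matrix `H = A E + (1 - E)` acts as `A` on
-- the unstable subspace and trivially on the stable one.
theorem exists_unstable_part (A : Matrix n n ℝ) :
    ∃ H E : Matrix n n ℝ, |H.det| = unstableDet A ∧ (∀ k : ℕ, H ^ k = E * A ^ k + (1 - E)) ∧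
      ∀ θ : ℝ, 1 < θ → ∃ c : ℝ, 0 < c ∧
        ∀ k : ℕ, ‖H⁻¹ ^ k‖ ≤ c * θ ^ k ∧ ‖H⁻¹ ^ k * A ^ k‖ ≤ c * θ ^ k := by
  obtain ⟨E, hE, hAE, hdet, hinv, hstab⟩ := exists_unstable_idempotent_growth A
  have hdet0 : (A * E + (1 - E)).det ≠ 0 :=
    abs_pos.mp (hdet ▸ one_pos.trans_le (one_le_unstableDet A))
  refine ⟨A * E + (1 - E), E, hdet, fun k => ?_, fun θ hθ => ?_⟩
  · rw [mul_add_one_sub_pow hE hAE, (hAE.pow_left k).eq]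
  set H := A * E + (1 - E)
  obtain ⟨η, hη, hηθ⟩ : ∃ η : ℝ, 1 < η ∧ η * η = θ :=
    ⟨√θ, Real.lt_sqrt_of_sq_lt (by simpa using hθ), Real.mul_self_sqrt (by positivity)⟩
  obtain ⟨c₁, hc₁, hb₁⟩ := hinv η hη
  obtain ⟨c₂, hc₂, hb₂⟩ := hstab η hη
  refine ⟨c₁ + (‖E‖ + c₁ * c₂ * ‖1 - E‖), by positivity, fun k => ?_⟩
  have hηk : 1 ≤ η ^ k := one_le_pow₀ hη.le
  have hθk : θ ^ k = η ^ k * η ^ k := by rw [← hηθ, mul_pow]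
  have hθk1 : 1 ≤ θ ^ k := hθk ▸ one_le_mul_of_one_le_of_one_le hηk hηk
  constructor
  · calc ‖H⁻¹ ^ k‖ ≤ c₁ * η ^ k := hb₁ k
      _ ≤ c₁ * θ ^ k := by
          rw [hθk]
          gcongr
          exact le_mul_of_one_le_left (by positivity) hηk
      _ ≤ _ := by
          gcongr
          exact le_add_of_nonneg_right (by positivity)
  · calc ‖H⁻¹ ^ k * A ^ k‖ ≤ ‖E‖ + ‖H⁻¹ ^ k‖ * ‖(A * (1 - E)) ^ k‖ * ‖1 - E‖ := by
          rw [inv_pow_mul_pow_eq hE hAE hdet0]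
          refine (norm_add_le _ _).trans (by gcongr; exact norm_mul₃_le)
      _ ≤ ‖E‖ * θ ^ k + (c₁ * η ^ k) * (c₂ * η ^ k) * ‖1 - E‖ := by
          gcongr
          exacts [le_mul_of_one_le_right (norm_nonneg E) hθk1, hb₁ k, hb₂ k]
      _ = (‖E‖ + c₁ * c₂ * ‖1 - E‖) * θ ^ k := by
          rw [hθk]
          ring
      _ ≤ _ := mul_le_mul_of_nonneg_right (le_add_of_nonneg_left hc₁.le) (by positivity)

end UnstablePart

theorem exists_pairwise_or_maximal {α : Type*} {r : α → α → Prop} (hsymm : ∀ x y, r x y → r y x)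
    (hirrefl : ∀ x, ¬ r x x) (G : Set α) (N : ℕ) :
    (∃ P : Finset α, ↑P ⊆ G ∧ P.card = N ∧ (P : Set α).Pairwise r) ∨
      ∃ P : Finset α, ↑P ⊆ G ∧ P.card < N ∧ ∀ x ∈ G, ∃ p ∈ P, ¬ r p x := by
  classical
  induction N with
  | zero => exact Or.inl ⟨∅, by simp⟩
  | succ N ih =>
    rcases ih with ⟨P, hPG, hcard, hP⟩ | ⟨P, hPG, hcard, hmax⟩
    · by_cases h : ∃ x ∈ G, ∀ p ∈ P, r p x
      · obtain ⟨x, hxG, hx⟩ := h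
        have hxP : x ∉ P := fun hxP => hirrefl x (hx x hxP)
        refine Or.inl ⟨insert x P, ?_, by rw [Finset.card_insert_of_notMem hxP, hcard], ?_⟩
        · simpa [Set.insert_subset_iff] using ⟨hxG, hPG⟩
        · simpa using hP.insert fun p hp _ => ⟨hsymm p x (hx p hp), hx p hp⟩
      · push Not at h
        exact Or.inr ⟨P, hPG, by omega, h⟩
    · exact Or.inr ⟨P, hPG, by omega, hmax⟩

theorem exists_one_lt_pow_le {θ : ℝ} (hθ : 1 < θ) (m : ℕ) : ∃ η : ℝ, 1 < η ∧ η ^ m ≤ θ := by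
  have hη : 1 < θ ^ ((m + 1 : ℕ) : ℝ)⁻¹ := Real.one_lt_rpow hθ (by positivity)
  refine ⟨_, hη, (pow_le_pow_right₀ hη.le m.le_succ).trans_eq ?_⟩
  exact Real.rpow_inv_natCast_pow (by positivity) m.succ_ne_zero

section Volume

variable {n : Type*} [Fintype n] [DecidableEq n]

theorem volume_preimage_mulVec_closedBall {H : Matrix n n ℝ} (hH : H.det ≠ 0) (x : n → ℝ) {r : ℝ}
    (hr : 0 ≤ r) :
    volume ((H *ᵥ ·) ⁻¹' Metric.closedBall x r) =
      ENNReal.ofReal (|H.det|⁻¹ * (2 * r) ^ Fintype.card n) := by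
  have h := Measure.addHaar_preimage_linearMap (μ := (volume : Measure (n → ℝ)))
    (f := Matrix.toLin' H) (by rwa [LinearMap.det_toLin']) (Metric.closedBall x r)
  rwa [LinearMap.det_toLin', Real.volume_pi_closedBall _ hr, abs_inv,
    ← ENNReal.ofReal_mul (by positivity)] at h

theorem card_mul_pow_le_of_preimage_subset {H : Matrix n n ℝ} (hH : H.det ≠ 0)
    {P : Finset (n → ℝ)} {δ R : ℝ} (hδ : 0 ≤ δ) (hR : 0 ≤ R)
    (hP : (P : Set (n → ℝ)).Pairwise fun x y => 2 * δ < ‖x - y‖)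
    (hsub : ∀ x ∈ P, (H *ᵥ ·) ⁻¹' Metric.closedBall x δ ⊆ Metric.closedBall 0 R) :
    P.card * δ ^ Fintype.card n ≤ |H.det| * R ^ Fintype.card n := by
  have hdisj : (P : Set (n → ℝ)).PairwiseDisjoint
      fun x => (H *ᵥ ·) ⁻¹' Metric.closedBall x δ := fun x hx y hy hxy =>
    (Metric.closedBall_disjoint_closedBall (by
      rw [dist_eq_norm, ← two_mul]
      exact hP hx hy hxy)).preimage _
  have hmeas : ∀ x ∈ P, MeasurableSet ((H *ᵥ ·) ⁻¹' Metric.closedBall x δ) := fun x _ =>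
    Metric.isClosed_closedBall.measurableSet.preimage (Continuous.matrix_mulVec continuous_const
      continuous_id).measurable
  have hvol := measure_mono (μ := volume) (Set.iUnion₂_subset hsub)
  rw [measure_biUnion_finset hdisj hmeas,
    Finset.sum_congr rfl fun x _ => volume_preimage_mulVec_closedBall hH x hδ, Finset.sum_const,
    nsmul_eq_mul, Real.volume_pi_closedBall _ hR, ← ENNReal.ofReal_natCast,
    ← ENNReal.ofReal_mul (by positivity), ENNReal.ofReal_le_ofReal_iff (by positivity), mul_pow,
    mul_pow] at hvol
  have hpos : 0 < |H.det| := abs_pos.mpr hH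
  have htwo : (0 : ℝ) < 2 ^ Fintype.card n := by positivity
  field_simp at hvol
  linarith

theorem volume_toReal_mul_abs_det_le {H : Matrix n n ℝ} (hH : H.det ≠ 0) {G : Set (n → ℝ)}
    {P : Finset (n → ℝ)} {κ : ℝ} (hκ : 0 ≤ κ)
    (hcov : G ⊆ ⋃ p ∈ P, (H *ᵥ ·) ⁻¹' Metric.closedBall (H *ᵥ p) κ) :
    (volume G).toReal * |H.det| ≤ P.card * (2 * κ) ^ Fintype.card n := by
  have hvol := (measure_mono (μ := volume) hcov).trans (measure_biUnion_finset_le P _)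
  rw [Finset.sum_congr rfl fun x _ => volume_preimage_mulVec_closedBall hH _ hκ,
    Finset.sum_const, nsmul_eq_mul, ← ENNReal.ofReal_natCast,
    ← ENNReal.ofReal_mul (by positivity)] at hvol
  have hreal := ENNReal.toReal_mono ENNReal.ofReal_ne_top hvol
  rw [ENNReal.toReal_ofReal (by positivity), mul_left_comm, ← div_eq_inv_mul,
    le_div_iff₀ (abs_pos.mpr hH)] at hreal
  exact hreal

theorem norm_le_of_det_ne_zero {H : Matrix n n ℝ} (hH : H.det ≠ 0) (A : Matrix n n ℝ) (k : ℕ)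
    (y b : n → ℝ) :
    ‖y‖ ≤ ‖H⁻¹ ^ k‖ * ‖H ^ k *ᵥ y - A ^ k *ᵥ b‖ + ‖H⁻¹ ^ k * A ^ k‖ * ‖b‖ := by
  have hdecomp : y = H⁻¹ ^ k *ᵥ (H ^ k *ᵥ y - A ^ k *ᵥ b) + (H⁻¹ ^ k * A ^ k) *ᵥ b := by
    rw [Matrix.mulVec_sub, Matrix.mulVec_mulVec, Matrix.mulVec_mulVec, inv_pow_mul_pow_self hH,
      Matrix.one_mulVec, sub_add_cancel]
  conv_lhs => rw [hdecomp]
  exact (norm_add_le _ _).trans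
    (add_le_add (Matrix.linfty_opNorm_mulVec _ _) (Matrix.linfty_opNorm_mulVec _ _))

theorem card_le_of_separated_image (A : Matrix n n ℝ) {θ : ℝ} (hθ : 1 < θ) :
    ∃ c : ℝ, 0 < c ∧ ∀ (k : ℕ) (P : Finset (n → ℝ)),
      ↑P ⊆ (A ^ k *ᵥ ·) '' Metric.closedBall 0 1 →
      (P : Set (n → ℝ)).Pairwise (fun x y => 1 / 2 < ‖x - y‖) →
      P.card ≤ c * (θ * unstableDet A) ^ k := by
  obtain ⟨H, -, hdet, -, hgrowth⟩ := exists_unstable_part A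
  have hdet0 : H.det ≠ 0 := abs_pos.mp (hdet ▸ one_pos.trans_le (one_le_unstableDet A))
  obtain ⟨η, hη, hηθ⟩ := exists_one_lt_pow_le hθ (Fintype.card n)
  obtain ⟨c, hc, hb⟩ := hgrowth η hη
  refine ⟨(8 * c) ^ Fintype.card n, by positivity, fun k P himage hsep => ?_⟩
  have hsub : ∀ x ∈ P, (H ^ k *ᵥ ·) ⁻¹' Metric.closedBall x (1 / 4) ⊆
      Metric.closedBall 0 (2 * c * η ^ k) := by
    intro x hx y hy
    obtain ⟨b, hb1, rfl⟩ := himage hx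
    rw [Set.mem_preimage, mem_closedBall_iff_norm] at hy
    rw [mem_closedBall_zero_iff] at hb1 ⊢
    calc ‖y‖ ≤ ‖H⁻¹ ^ k‖ * ‖H ^ k *ᵥ y - A ^ k *ᵥ b‖ + ‖H⁻¹ ^ k * A ^ k‖ * ‖b‖ :=
          norm_le_of_det_ne_zero hdet0 A k y b
      _ ≤ c * η ^ k * (1 / 4) + c * η ^ k * 1 := by
          gcongr
          exacts [(hb k).1, (hb k).2]
      _ ≤ 2 * c * η ^ k := by linarith [show 0 < c * η ^ k by positivity]
  have hcard := card_mul_pow_le_of_preimage_subset (H := H ^ k) (P := P) (δ := 1 / 4)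
    (H.det_pow k ▸ pow_ne_zero k hdet0) (by norm_num) (by positivity)
    (by simpa only [show (2 : ℝ) * (1 / 4) = 1 / 2 by norm_num] using hsep) hsub
  have hηk : (η ^ k) ^ Fintype.card n ≤ θ ^ k := by
    rw [pow_right_comm]
    gcongr
  have hunst := one_le_unstableDet A
  rw [Matrix.det_pow, abs_pow, hdet, one_div, inv_pow, ← div_eq_mul_inv,
    div_le_iff₀ (by positivity)] at hcard
  calc (P.card : ℝ) ≤ unstableDet A ^ k * (2 * c * η ^ k) ^ Fintype.card n *
        4 ^ Fintype.card n := hcard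
    _ = (8 * c) ^ Fintype.card n * ((η ^ k) ^ Fintype.card n * unstableDet A ^ k) := by
        rw [mul_pow (2 * c), show 8 * c = 2 * c * 4 by ring, mul_pow (2 * c)]
        ring
    _ ≤ (8 * c) ^ Fintype.card n * (θ * unstableDet A) ^ k := by
        rw [mul_pow θ]
        gcongr

theorem exists_separated_image (A : Matrix n n ℝ) {G : Set (n → ℝ)} (hbdd : Bornology.IsBounded G)
    (hG : volume G ≠ 0) {R : ℝ} (hR : 0 ≤ R) :
    ∃ c : ℝ, 0 < c ∧ ∀ k : ℕ, ∃ P : Finset (n → ℝ), ↑P ⊆ G ∧ c * unstableDet A ^ k ≤ P.card ∧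
      (P : Set (n → ℝ)).Pairwise fun x y => R < ‖A ^ k *ᵥ (x - y)‖ := by
  obtain ⟨H, E, hdet, hpow, -⟩ := exists_unstable_part A
  have hdet0 : H.det ≠ 0 := abs_pos.mp (hdet ▸ one_pos.trans_le (one_le_unstableDet A))
  set κ : ℝ := 1 + (‖E‖ * R + ‖1 - E‖ * Metric.diam G)
  have hκ0 : 0 < κ := add_pos_of_pos_of_nonneg one_pos
    (add_nonneg (by positivity) (mul_nonneg (norm_nonneg _) Metric.diam_nonneg))
  have hvol : 0 < (volume G).toReal := ENNReal.toReal_pos hG hbdd.measure_lt_top.ne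
  refine ⟨(volume G).toReal / (2 * κ) ^ Fintype.card n, by positivity, fun k => ?_⟩
  set N := (volume G).toReal / (2 * κ) ^ Fintype.card n * unstableDet A ^ k
  rcases exists_pairwise_or_maximal (r := fun x y => R < ‖A ^ k *ᵥ (x - y)‖)
    (fun x y h => by rwa [← neg_sub x y, Matrix.mulVec_neg, norm_neg])
    (fun x => by simpa using hR) G ⌈N⌉₊ with ⟨P, hPG, hcard, hP⟩ | ⟨P, hPG, hcard, hmax⟩
  · exact ⟨P, hPG, hcard ▸ Nat.le_ceil _, hP⟩
  have hcov : G ⊆ ⋃ p ∈ P, (H ^ k *ᵥ ·) ⁻¹' Metric.closedBall (H ^ k *ᵥ p) κ := by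
    intro x hx
    obtain ⟨p, hp, hpx⟩ := hmax x hx
    refine Set.mem_iUnion₂.mpr ⟨p, hp, mem_closedBall_iff_norm'.mpr ?_⟩
    calc ‖H ^ k *ᵥ p - H ^ k *ᵥ x‖
        = ‖E *ᵥ (A ^ k *ᵥ (p - x)) + (1 - E) *ᵥ (p - x)‖ := by
          rw [← Matrix.mulVec_sub, hpow, Matrix.add_mulVec, Matrix.mulVec_mulVec]
      _ ≤ ‖E‖ * ‖A ^ k *ᵥ (p - x)‖ + ‖1 - E‖ * ‖p - x‖ := (norm_add_le _ _).trans
          (add_le_add (Matrix.linfty_opNorm_mulVec _ _) (Matrix.linfty_opNorm_mulVec _ _))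
      _ ≤ ‖E‖ * R + ‖1 - E‖ * Metric.diam G := by
          gcongr
          exacts [not_lt.mp hpx, dist_eq_norm p x ▸ Metric.dist_le_diam_of_mem hbdd (hPG hp) hx]
      _ ≤ κ := le_add_of_nonneg_left zero_le_one
  have hle := volume_toReal_mul_abs_det_le (H.det_pow k ▸ pow_ne_zero k hdet0) hκ0.le hcov
  rw [Matrix.det_pow, abs_pow, hdet, ← div_le_iff₀ (by positivity), ← div_mul_eq_mul_div] at hle
  exact absurd (Nat.lt_ceil.mp hcard) hle.not_gt

end Volume

-- Gilbert–Varshamov: `x` conflicts with a codeword `p` when `p + w = x + w'` for noise words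
-- `w, w'`, which for given `p, w, w'` happens for at most one `x`.
theorem exists_pairwise_add_ne_add {G : Type*} [Fintype G] [Add G] [IsRightCancelAdd G]
    {W : Finset G} (hW : W.Nonempty) {N : ℕ} (hN : N * W.card ^ 2 ≤ Fintype.card G) :
    ∃ P : Finset G, P.card = N ∧
      (P : Set G).Pairwise fun c c' => ∀ w ∈ W, ∀ w' ∈ W, c + w ≠ c' + w' := by
  rcases exists_pairwise_or_maximal (r := fun c c' : G => ∀ w ∈ W, ∀ w' ∈ W, c + w ≠ c' + w')
    (fun c c' h w hw w' hw' => (h w' hw' w hw).symm)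
    (fun c h => hW.elim fun w hw => h w hw w hw rfl) Set.univ N with
    ⟨P, -, hcard, hP⟩ | ⟨P, -, hcard, hmax⟩
  · exact ⟨P, hcard, hP⟩
  · push Not at hmax
    choose! p hp w hw w' hw' hadd using fun x => hmax x trivial
    have hmaps : ∀ x ∈ Finset.univ, (p x, w x, w' x) ∈ P ×ˢ W ×ˢ W := by simp [hp, hw, hw']
    have hinj : Set.InjOn (fun x => (p x, w x, w' x)) (Finset.univ : Finset G) := by
      intro x _ y _ hxy
      simp only [Prod.mk.injEq] at hxy
      obtain ⟨hpxy, hwxy, hwxy'⟩ := hxy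
      refine add_right_cancel (b := w' x) ?_
      rw [← hadd x, hpxy, hwxy, hadd y, hwxy']
    have hle := Finset.card_le_card_of_injOn _ hmaps hinj
    rw [Finset.card_univ, Finset.card_product, Finset.card_product, ← sq] at hle
    exact absurd (hN.trans hle) (not_le.mpr (by have := hW.card_pos; gcongr))

namespace AdditiveNoiseChannel

variable {S X : Type*} (K : AdditiveNoiseChannel S X)

/-- An infinite walk in the state graph of the channel. -/
def IsWalk (σ : ℕ → S) : Prop := ∀ t, K.Edge (σ t) (σ (t + 1))

theorem exists_edge (s : S) : ∃ s', K.Edge s s' := by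
  obtain ⟨s', h, -⟩ := Relation.TransGen.head'_iff.mp (K.strongly_connected s s)
  exact ⟨s', h⟩

theorem exists_isWalk (s : S) : ∃ σ, K.IsWalk σ ∧ σ 0 = s := by
  choose next hnext using K.exists_edge
  refine ⟨fun t => next^[t] s, fun t => ?_, rfl⟩
  simp only [Function.iterate_succ_apply']
  exact hnext _

variable {K} in
theorem IsWalk.shift {σ : ℕ → S} (h : K.IsWalk σ) (m : ℕ) : K.IsWalk fun t => σ (t + m) :=
  fun t => by simpa only [add_right_comm] using h (t + m)

/-- The noise sequence of the channel along the state sequence `σ`. -/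
def walkNoise (σ : ℕ → S) (t : ℕ) : X := K.label (σ t) (σ (t + 1))

variable {K} in
theorem IsWalk.isNoise {σ : ℕ → S} (h : K.IsWalk σ) : K.IsNoise (K.walkNoise σ) :=
  ⟨σ, fun t => ⟨h t, rfl⟩⟩

section Words

variable [Fintype S]

open Classical in
/-- The noise words of length `T` that the channel can produce when started in state `s`. -/
def words (s : S) : (T : ℕ) → Finset (Fin T → X)
  | 0 => {Fin.elim0}
  | T + 1 => (Finset.univ.filter fun s' => K.Edge s s').biUnion fun s' =>
      (words s' T).image fun w => (Fin.cons (K.label s s') w : Fin (T + 1) → X)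

variable {K} in
theorem mem_words {s : S} {T : ℕ} {w : Fin T → X} :
    w ∈ K.words s T ↔
      ∃ σ, K.IsWalk σ ∧ σ 0 = s ∧ ∀ i : Fin T, w i = K.walkNoise σ i := by
  classical
  induction T generalizing s with
  | zero =>
    obtain ⟨σ, hσ, h0⟩ := K.exists_isWalk s
    simp only [words, Finset.mem_singleton]
    exact ⟨fun _ => ⟨σ, hσ, h0, fun i => i.elim0⟩, fun _ => Subsingleton.elim _ _⟩
  | succ T ih =>
    simp only [words, Finset.mem_biUnion, Finset.mem_filter, Finset.mem_univ, true_and,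
      Finset.mem_image]
    constructor
    · rintro ⟨s', hs', u, hu, rfl⟩
      obtain ⟨σ, hσ, rfl, hlabel⟩ := ih.mp hu
      refine ⟨fun t => Nat.casesOn t s σ, ?_, rfl, Fin.cases rfl fun i => ?_⟩
      · rintro (_ | t)
        exacts [hs', hσ t]
      · simpa [walkNoise] using hlabel i
    · rintro ⟨σ, hσ, rfl, hlabel⟩
      refine ⟨σ 1, hσ 0, fun i => w i.succ, ih.mpr ⟨_, hσ.shift 1, rfl, fun i => ?_⟩, ?_⟩
      · simpa [walkNoise] using hlabel i.succ
      · refine funext (Fin.cases ?_ fun i => ?_)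
        · simpa [walkNoise] using (hlabel 0).symm
        · simp

variable {K} in
theorem IsWalk.walkNoise_mem_words {σ : ℕ → S} (h : K.IsWalk σ) (T : ℕ) :
    (fun i : Fin T => K.walkNoise σ i) ∈ K.words (σ 0) T :=
  mem_words.mpr ⟨σ, h, rfl, fun _ => rfl⟩

theorem words_nonempty (s : S) (T : ℕ) : (K.words s T).Nonempty := by
  obtain ⟨σ, hσ, rfl⟩ := K.exists_isWalk s
  exact ⟨_, hσ.walkNoise_mem_words T⟩

open Classical in
theorem card_words_succ (s : S) (T : ℕ) :
    (K.words s (T + 1)).card = ∑ s', if K.Edge s s' then (K.words s' T).card else 0 := by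
  rw [words, Finset.card_biUnion, Finset.sum_filter]
  · refine Finset.sum_congr rfl fun s' _ => if_congr Iff.rfl ?_ rfl
    exact Finset.card_image_of_injective _
      (Fin.cons_right_injective (α := fun _ : Fin (T + 1) => X) _)
  · intro s₁ h₁ s₂ h₂ hne
    refine Finset.disjoint_left.mpr fun w hw₁ hw₂ => hne ?_
    obtain ⟨u₁, -, rfl⟩ := Finset.mem_image.mp hw₁
    obtain ⟨u₂, -, h⟩ := Finset.mem_image.mp hw₂
    have hlabel := congrFun h 0
    simp only [Fin.cons_zero] at hlabel
    exact K.label_injective s s₁ s₂ (Finset.mem_filter.mp h₁).2 (Finset.mem_filter.mp h₂).2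
      hlabel.symm

theorem card_words_le_of_edge {s s' : S} (h : K.Edge s s') (T : ℕ) :
    (K.words s' T).card ≤ (K.words s (T + 1)).card := by
  classical
  rw [card_words_succ]
  simpa [h] using Finset.single_le_sum
    (f := fun u => if K.Edge s u then (K.words u T).card else 0) (fun _ _ => Nat.zero_le _)
    (Finset.mem_univ s')

theorem card_words_mono (s : S) : Monotone fun T => (K.words s T).card := by
  classical
  refine monotone_nat_of_le_succ fun T => ?_
  have hsub : K.words s T ⊆ (K.words s (T + 1)).image fun w i => w i.castSucc := by
    intro w hw
    obtain ⟨σ, hσ, rfl, hlabel⟩ := mem_words.mp hw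
    exact Finset.mem_image.mpr
      ⟨_, hσ.walkNoise_mem_words (T + 1), funext fun i => by simp [hlabel i]⟩
  exact (Finset.card_le_card hsub).trans Finset.card_image_le

theorem exists_card_words_le_of_reachable (s s' : S) :
    ∃ k, ∀ T, (K.words s' T).card ≤ (K.words s (T + k)).card := by
  induction K.strongly_connected s s' with
  | single h => exact ⟨1, K.card_words_le_of_edge h⟩
  | tail _ h ih =>
    obtain ⟨k, hk⟩ := ih
    refine ⟨k + 1, fun T => (K.card_words_le_of_edge h T).trans ((hk (T + 1)).trans_eq ?_)⟩
    rw [add_assoc, add_comm 1]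

end Words

section Growth

variable [Fintype S] [DecidableEq S]

theorem sum_norm_adjacency_pow (s : S) (T : ℕ) :
    ∑ s', ‖(K.adjacency ^ T) s s'‖ = (K.words s T).card := by
  classical
  let m : Matrix S S ℕ := Matrix.of fun s s' => if K.Edge s s' then 1 else 0
  have hcast : K.adjacency = (Nat.castRingHom ℂ).mapMatrix m := by
    ext i j
    simp [adjacency, m]
  have hsum : ∀ T s, ∑ s', (m ^ T) s s' = (K.words s T).card := by
    intro T
    induction T with
    | zero => simp [words, Matrix.one_apply]
    | succ T ih =>
      intro s
      simp only [pow_succ', Matrix.mul_apply]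
      rw [Finset.sum_comm, card_words_succ]
      refine Finset.sum_congr rfl fun u _ => ?_
      simp [ih, m]
  rw [← hsum, hcast, ← map_pow]
  simp

theorem card_words_le_norm (s : S) (T : ℕ) : (K.words s T).card ≤ ‖K.adjacency ^ T‖ := by
  rw [← sum_norm_adjacency_pow, Matrix.linfty_opNorm_def]
  have hrow := NNReal.coe_le_coe.mpr (Finset.le_sup
    (f := fun i => ∑ j, ‖(K.adjacency ^ T) i j‖₊) (Finset.mem_univ s))
  simpa only [NNReal.coe_sum, coe_nnnorm] using hrow

variable [Nonempty S]

theorem exists_card_words_eq_norm (T : ℕ) : ∃ s, (K.words s T).card = ‖K.adjacency ^ T‖ := by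
  obtain ⟨s, -, hs⟩ := Finset.exists_mem_eq_sup (Finset.univ : Finset S) Finset.univ_nonempty
    fun i => ∑ j, ‖(K.adjacency ^ T) i j‖₊
  refine ⟨s, ?_⟩
  rw [← sum_norm_adjacency_pow, Matrix.linfty_opNorm_def, hs]
  simp

theorem exists_norm_eq_perronEigenvalue : ∃ z ∈ spectrum ℂ K.adjacency,
    ‖z‖ = K.perronEigenvalue ∧ spectralRadius ℂ K.adjacency = ENNReal.ofReal ‖z‖ := by
  obtain ⟨z, hz, hradius⟩ := spectrum.exists_nnnorm_eq_spectralRadius K.adjacency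
  exact ⟨z, hz, by simp [perronEigenvalue, ← hradius], by rw [← hradius, ofReal_norm]; rfl⟩

theorem perronEigenvalue_pow_le_norm (T : ℕ) :
    K.perronEigenvalue ^ T ≤ ‖K.adjacency ^ T‖ := by
  obtain ⟨z, hz, hnorm, -⟩ := K.exists_norm_eq_perronEigenvalue
  rw [← hnorm, ← norm_pow]
  exact spectrum.norm_le_norm_of_mem (spectrum.pow_mem_pow _ T hz)

theorem one_le_perronEigenvalue : 1 ≤ K.perronEigenvalue := by
  obtain ⟨z, -, hnorm, hradius⟩ := K.exists_norm_eq_perronEigenvalue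
  obtain ⟨s⟩ := ‹Nonempty S›
  have hgelfand : 1 ≤ spectralRadius ℂ K.adjacency :=
    ge_of_tendsto' (spectrum.pow_norm_pow_one_div_tendsto_nhds_spectralRadius K.adjacency)
      fun T => ENNReal.one_le_ofReal.mpr <| Real.one_le_rpow
        (le_trans (by exact_mod_cast (K.words_nonempty s T).card_pos) (K.card_words_le_norm s T))
        (by positivity)
  rwa [hradius, ENNReal.one_le_ofReal, hnorm] at hgelfand

theorem exists_perronEigenvalue_pow_le_card_words :
    ∃ k, ∀ s T, K.perronEigenvalue ^ T ≤ (K.words s (T + k)).card := by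
  choose k hk using K.exists_card_words_le_of_reachable
  refine ⟨∑ p : S × S, k p.1 p.2, fun s T => ?_⟩
  obtain ⟨s', hs'⟩ := K.exists_card_words_eq_norm T
  have hkle : k s s' ≤ ∑ p : S × S, k p.1 p.2 :=
    Finset.single_le_sum (f := fun p : S × S => k p.1 p.2) (fun _ _ => Nat.zero_le _)
      (Finset.mem_univ (s, s'))
  refine (K.perronEigenvalue_pow_le_norm T).trans (hs'.symm.le.trans ?_)
  exact_mod_cast (hk s s' T).trans (K.card_words_mono s (Nat.add_le_add_left hkle T))

theorem exists_card_words_le {θ : ℝ} (hθ : 1 < θ) :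
    ∃ c : ℝ, 0 < c ∧ ∀ s T, (K.words s T).card ≤ c * (θ * K.perronEigenvalue) ^ T := by
  obtain ⟨z, -, hnorm, hradius⟩ := K.exists_norm_eq_perronEigenvalue
  have hpos : 0 < K.perronEigenvalue := one_pos.trans_le K.one_le_perronEigenvalue
  have hlt : spectralRadius ℂ K.adjacency < ENNReal.ofReal (θ * K.perronEigenvalue) := by
    rw [hradius, hnorm, ENNReal.ofReal_lt_ofReal_iff (by positivity)]
    exact lt_mul_of_one_lt_left hpos hθ
  obtain ⟨c, hc, hpow⟩ := exists_norm_pow_le_of_spectralRadius_lt hlt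
  exact ⟨c, hc, fun s T => (K.card_words_le_norm s T).trans (hpow T)⟩

theorem rpow_entropy [Fintype X] [Nontrivial X] :
    (Fintype.card X : ℝ) ^ K.entropy = K.perronEigenvalue := by
  have hq : (1 : ℝ) < Fintype.card X := by exact_mod_cast Fintype.one_lt_card
  exact Real.rpow_logb (by positivity) hq.ne' (one_pos.trans_le K.one_le_perronEigenvalue)

end Growth

end AdditiveNoiseChannel

open Classical in
theorem sum_filter_logb_norm {E : Type*} [NormedAddCommGroup E] (b : ℝ) (m : Multiset E) :
    ((m.filter fun z => 1 ≤ ‖z‖).map fun z => Real.logb b ‖z‖).sum =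
      Real.logb b (m.map fun z => max 1 ‖z‖).prod := by
  induction m using Multiset.induction_on with
  | empty => simp
  | cons z m ih =>
    have hpos : 0 < (m.map fun z => max 1 ‖z‖).prod :=
      Multiset.prod_pos fun _ h => by
        obtain ⟨y, -, rfl⟩ := Multiset.mem_map.mp h
        positivity
    rw [Multiset.map_cons, Multiset.prod_cons, Real.logb_mul (by positivity) hpos.ne', ← ih]
    rcases le_or_gt 1 ‖z‖ with hz | hz
    · simp [Multiset.filter_cons_of_pos (p := fun z : E => 1 ≤ ‖z‖) _ hz, hz]
    · simp [Multiset.filter_cons_of_neg (p := fun z : E => 1 ≤ ‖z‖) _ hz.not_ge, hz.le]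

theorem LTISystem.rpow_entropy {nx ny : ℕ} (P : LTISystem nx ny) {q : ℕ} (hq : 1 < q) :
    (q : ℝ) ^ P.entropy q = unstableDet P.A := by
  have hq' : (1 : ℝ) < q := by exact_mod_cast hq
  rw [entropy, sum_filter_logb_norm]
  exact Real.rpow_logb (by positivity) hq'.ne' (one_pos.trans_le (one_le_unstableDet P.A))

section Converse

theorem exists_isOpen_forall_le {Z ι : Type*} [TopologicalSpace Z] [BaireSpace Z] [Nonempty Z]
    {f : ι → Z → ℝ} (hf : ∀ i, LowerSemicontinuous (f i)) (hbdd : ∀ z, ∃ M, ∀ i, f i z ≤ M) :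
    ∃ (M : ℕ) (U : Set Z), IsOpen U ∧ U.Nonempty ∧ ∀ z ∈ U, ∀ i, f i z ≤ M := by
  have hclosed : ∀ M : ℕ, IsClosed {z | ∀ i, f i z ≤ M} := fun M => by
    rw [Set.ofPred_forall]
    exact isClosed_iInter fun i => (hf i).isClosed_preimage (M : ℝ)
  have hcover : ⋃ M : ℕ, {z | ∀ i, f i z ≤ M} = Set.univ := by
    refine Set.eq_univ_of_forall fun z => ?_
    obtain ⟨M, hM⟩ := hbdd z
    obtain ⟨N, hN⟩ := exists_nat_ge M
    exact Set.mem_iUnion.mpr ⟨N, fun i => (hM i).trans hN⟩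
  obtain ⟨M, hM⟩ := nonempty_interior_of_iUnion_of_closed hclosed hcover
  exact ⟨M, _, isOpen_interior, hM, fun z hz => interior_subset hz⟩

theorem continuous_of_prefix {S Y : Type*} [TopologicalSpace S] [DiscreteTopology S]
    [TopologicalSpace Y] {f : (ℕ → S) → Y} (T : ℕ)
    (hf : ∀ σ τ, (∀ i < T, σ i = τ i) → f σ = f τ) : Continuous f :=
  (IsLocallyConstant.iff_exists_open f).mpr (fun τ =>
    ⟨PiNat.cylinder τ T, PiNat.isOpen_cylinder _ _ _, PiNat.self_mem_cylinder _ _,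
      fun σ hσ => hf σ τ hσ⟩) |>.continuous

theorem eventually_mul_pow_lt_mul_pow {a b c : ℝ} (ha : 0 ≤ a) (hab : a < b) (hc : 0 < c)
    (C : ℝ) : ∀ᶠ k : ℕ in atTop, C * a ^ k < c * b ^ k := by
  have hb : 0 < b := ha.trans_lt hab
  have hlim : Tendsto (fun k : ℕ => C * (a / b) ^ k) atTop (𝓝 0) := by
    simpa using (tendsto_pow_atTop_nhds_zero_of_lt_one (by positivity)
      ((div_lt_one hb).mpr hab)).const_mul C
  filter_upwards [hlim.eventually_lt_const hc] with k hk
  rwa [div_pow, ← mul_div_assoc, div_lt_iff₀ (by positivity)] at hk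

namespace AdditiveNoiseChannel

variable {S X : Type*} {K : AdditiveNoiseChannel S X}

theorem isClosed_isWalk [TopologicalSpace S] [DiscreteTopology S] :
    IsClosed {σ | K.IsWalk σ} := by
  simp only [IsWalk, Set.ofPred_forall]
  exact isClosed_iInter fun t =>
    (isClosed_discrete {e : S × S | K.Edge e.1 e.2}).preimage
      (f := fun σ : ℕ → S => (σ t, σ (t + 1))) (by fun_prop)

-- Baire category in the compact space of walks of the graph.
theorem exists_forall_le_of_prefix [Finite S] [Nonempty S] {g : (ℕ → S) → ℕ → ℝ}
    (hcausal : ∀ t σ τ, (∀ i ≤ t, σ i = τ i) → g σ t = g τ t)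
    (hbdd : ∀ σ, K.IsWalk σ → ∃ M, ∀ t, g σ t ≤ M) :
    ∃ (M m : ℕ) (σ₀ : ℕ → S), K.IsWalk σ₀ ∧
      ∀ σ, K.IsWalk σ → (∀ i < m, σ i = σ₀ i) → ∀ t, g σ t ≤ M := by
  let : TopologicalSpace S := ⊥
  have : DiscreteTopology S := ⟨rfl⟩
  have : CompactSpace {σ | K.IsWalk σ} :=
    isCompact_iff_compactSpace.mp isClosed_isWalk.isCompact
  have : Nonempty {σ | K.IsWalk σ} :=
    (K.exists_isWalk (Classical.arbitrary S)).elim fun σ hσ => ⟨⟨σ, hσ.1⟩⟩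
  have hcont : ∀ t, Continuous fun σ => g σ t := fun t =>
    continuous_of_prefix (t + 1) fun σ τ h => hcausal t σ τ fun i hi => h i (Nat.lt_succ_of_le hi)
  obtain ⟨M, -, ⟨V, hV, rfl⟩, ⟨σ₀, hσ₀⟩, hM⟩ :=
    exists_isOpen_forall_le (Z := {σ | K.IsWalk σ}) (f := fun t σ => g σ t)
      (fun t => ((hcont t).comp continuous_subtype_val).lowerSemicontinuous) fun σ => hbdd σ σ.2
  obtain ⟨-, ⟨τ, m, rfl⟩, hτ, hsub⟩ :=
    (PiNat.isTopologicalBasis_cylinders fun _ => S).exists_subset_of_mem_open hσ₀ hV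
  exact ⟨M, m, σ₀, σ₀.2, fun σ hσ hprefix =>
    hM ⟨σ, hσ⟩ (hsub fun i hi => (hprefix i hi).trans (hτ i hi))⟩

theorem exists_measure_ne_zero_forall_le_of_prefix [Finite S] [Nonempty S] {α : Type*}
    [MeasurableSpace α] {μ : Measure α} {s : Set α} (hs : μ s ≠ 0) {g : α → (ℕ → S) → ℕ → ℝ}
    (hcausal : ∀ x t σ τ, (∀ i ≤ t, σ i = τ i) → g x σ t = g x τ t)
    (hbdd : ∀ x ∈ s, ∀ σ, K.IsWalk σ → ∃ M, ∀ t, g x σ t ≤ M) :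
    ∃ (M m : ℕ) (σ₀ : ℕ → S), K.IsWalk σ₀ ∧
      μ {x ∈ s | ∀ σ, K.IsWalk σ → (∀ i < m, σ i = σ₀ i) → ∀ t, g x σ t ≤ M} ≠ 0 := by
  by_contra! hnull
  let G : (ℕ × Σ m, Fin m → S) → Set α := fun ⟨M, m, p⟩ =>
    {x ∈ s | (∃ σ₀, K.IsWalk σ₀ ∧ ∀ i : Fin m, σ₀ i = p i) ∧
      ∀ σ, K.IsWalk σ → (∀ i : Fin m, σ i = p i) → ∀ t, g x σ t ≤ M}
  have hcover : s ⊆ ⋃ p, G p := fun x hx => by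
    obtain ⟨M, m, σ₀, hσ₀, hM⟩ := exists_forall_le_of_prefix (hcausal x) (hbdd x hx)
    exact Set.mem_iUnion.mpr ⟨⟨M, m, fun i => σ₀ i⟩, hx, ⟨σ₀, hσ₀, fun _ => rfl⟩,
      fun σ hσ hprefix => hM σ hσ fun i hi => hprefix ⟨i, hi⟩⟩
  refine hs (measure_mono_null hcover (measure_iUnion_null fun ⟨M, m, p⟩ => ?_))
  by_cases hp : ∃ σ₀, K.IsWalk σ₀ ∧ ∀ i : Fin m, σ₀ i = p i
  · obtain ⟨σ₀, hσ₀, hp⟩ := hp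
    refine measure_mono_null (fun x hx => And.intro hx.1 fun σ hσ hprefix => ?_) (hnull M m σ₀ hσ₀)
    exact hx.2.2 σ hσ fun i => (hprefix i i.2).trans (hp i)
  · exact measure_mono_null (t := ∅) (fun x hx => (hp hx.2.1).elim) measure_empty

theorem IsWalk.exists_splice {σ₀ τ : ℕ → S} (hσ₀ : K.IsWalk σ₀) (hτ : K.IsWalk τ) {m : ℕ}
    (h0 : τ 0 = σ₀ m) :
    ∃ σ, K.IsWalk σ ∧ (∀ i ≤ m, σ i = σ₀ i) ∧ ∀ i, σ (m + i) = τ i := by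
  have hprefix : ∀ i ≤ m, (if i < m then σ₀ i else τ (i - m)) = σ₀ i := fun i hi => by
    rcases hi.lt_or_eq with h | rfl <;> simp [*]
  refine ⟨fun i => if i < m then σ₀ i else τ (i - m), fun t => ?_, hprefix, fun i => by simp⟩
  rcases lt_or_ge t m with h | h
  · simpa only [hprefix t h.le, hprefix (t + 1) h] using hσ₀ t
  · simpa only [h.not_gt, (Nat.le_succ_of_le h).not_gt, if_false, Nat.sub_add_comm h] using
      hτ (t - m)

theorem IsWalk.exists_walkNoise_eq [Fintype S] {σ₀ : ℕ → S} (hσ₀ : K.IsWalk σ₀) {m T : ℕ}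
    {w : Fin T → X} (hw : w ∈ K.words (σ₀ m) T) :
    ∃ σ, K.IsWalk σ ∧ (∀ i < m, σ i = σ₀ i) ∧ ∀ i : Fin T, K.walkNoise σ (m + i) = w i := by
  obtain ⟨τ, hτ, h0, hlabel⟩ := mem_words.mp hw
  obtain ⟨σ, hσ, hprefix, htail⟩ := hσ₀.exists_splice hτ h0
  refine ⟨σ, hσ, fun i hi => hprefix i hi.le, fun i => ?_⟩
  rw [hlabel, walkNoise, htail, add_assoc, htail, walkNoise]

end AdditiveNoiseChannel

theorem LTISystem.state_zero_disturbance {nx ny : ℕ} (P : LTISystem nx ny) (x : Fin nx → ℝ)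
    (t : ℕ) : P.state x 0 t = P.A ^ t *ᵥ x := by
  induction t with
  | zero => simp [LTISystem.state]
  | succ t ih => simp [LTISystem.state, ih, pow_succ']

namespace CoderEstimator

variable {nx ny : ℕ} {X : Type*} (F : CoderEstimator nx ny X)

theorem estimate_congr {r r' : ℕ → X} {t : ℕ} (h : ∀ i < t, r i = r' i) :
    F.estimate r t = F.estimate r' t := by
  cases t with
  | zero => rfl
  | succ t => exact congrArg (F.estimator t) (funext fun i => h i i.2)

variable {S : Type*} [Add X] (P : LTISystem nx ny) (K : AdditiveNoiseChannel S X)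

theorem error_walkNoise_congr {x₀ : Fin nx → ℝ} {v : ℕ → Fin nx → ℝ} {w : ℕ → Fin ny → ℝ}
    {t : ℕ} {σ τ : ℕ → S} (h : ∀ i ≤ t, σ i = τ i) :
    F.error P x₀ v w (K.walkNoise σ) t = F.error P x₀ v w (K.walkNoise τ) t := by
  refine congrArg (P.state x₀ v t - ·) (F.estimate_congr fun i hi => ?_)
  rw [channelOutput, channelOutput, AdditiveNoiseChannel.walkNoise, AdditiveNoiseChannel.walkNoise,
    h i hi.le, h (i + 1) hi]

variable {P} {F} in
theorem norm_pow_mulVec_sub_le {x x' : Fin nx → ℝ} {z z' : ℕ → X} {t : ℕ} {M : ℝ}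
    (hr : ∀ i < t, F.channelOutput (P.output x 0 0) z i = F.channelOutput (P.output x' 0 0) z' i)
    (hx : ‖F.error P x 0 0 z t‖ ≤ M) (hx' : ‖F.error P x' 0 0 z' t‖ ≤ M) :
    ‖P.A ^ t *ᵥ (x - x')‖ ≤ 2 * M := by
  rw [error, P.state_zero_disturbance] at hx hx'
  rw [F.estimate_congr hr] at hx
  rw [Matrix.mulVec_sub, ← sub_sub_sub_cancel_right]
  linarith [norm_sub_le_of_le hx hx']

-- Different pairs of initial state and noise word lead to different received words: the received
-- word determines the initial state since the errors are bounded, hence the channel input, and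
-- subtracting the latter leaves the noise word.
theorem card_mul_card_words_le [IsLeftCancelAdd X] [Fintype S] [Fintype X] {σ₀ : ℕ → S}
    (hσ₀ : K.IsWalk σ₀) {m T : ℕ} {M : ℝ} {Q : Finset (Fin nx → ℝ)}
    (hQ : ∀ x ∈ Q, ∀ σ, K.IsWalk σ → (∀ i < m, σ i = σ₀ i) →
      ∀ t, ‖F.error P x 0 0 (K.walkNoise σ) t‖ ≤ M)
    (hsep : (Q : Set (Fin nx → ℝ)).Pairwise fun x y => 2 * M < ‖P.A ^ (m + T) *ᵥ (x - y)‖) :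
    Q.card * (K.words (σ₀ m) T).card ≤ Fintype.card X ^ (m + T) := by
  have : Nonempty S := ⟨σ₀ 0⟩
  choose! ω hω hprefix hnoise using
    fun (w : Fin T → X) (hw : w ∈ K.words (σ₀ m) T) => hσ₀.exists_walkNoise_eq hw
  let r : (Fin nx → ℝ) × (Fin T → X) → Fin (m + T) → X := fun p i =>
    F.channelOutput (P.output p.1 0 0) (K.walkNoise (ω p.2)) i
  have hinj : Set.InjOn r (Q ×ˢ K.words (σ₀ m) T : Finset _) := by
    rintro ⟨x, w⟩ hxw ⟨x', w'⟩ hxw' heq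
    obtain ⟨hx, hw⟩ := Finset.mem_product.mp hxw
    obtain ⟨hx', hw'⟩ := Finset.mem_product.mp hxw'
    obtain rfl : x = x' := by
      by_contra hne
      exact (hsep hx hx' hne).not_ge <| norm_pow_mulVec_sub_le
        (fun i hi => congrFun heq ⟨i, hi⟩) (hQ x hx _ (hω w hw) (hprefix w hw) _)
        (hQ x' hx' _ (hω w' hw') (hprefix w' hw') _)
    refine Prod.ext rfl (funext fun i => ?_)
    change w i = w' i
    rw [← hnoise w hw i, ← hnoise w' hw' i]
    exact add_left_cancel (congrFun heq ⟨m + i, by omega⟩)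
  simpa using Finset.card_le_card_of_injOn (t := Finset.univ) r (fun _ _ => Finset.mem_univ _) hinj

theorem exists_unbounded_error [IsLeftCancelAdd X] [Fintype S] [DecidableEq S] [Nonempty S]
    [Fintype X] (hrate : Fintype.card X < unstableDet P.A * K.perronEigenvalue)
    {l : ℝ} (hl : 0 < l) :
    ∃ x₀ ∈ Metric.closedBall (0 : Fin nx → ℝ) l, ∃ z : ℕ → X, K.IsNoise z ∧
      ∀ M : ℝ, ∃ t, M < ‖F.error P x₀ 0 0 z t‖ := by
  by_contra! hbdd
  obtain ⟨M, m, σ₀, hσ₀, hvol⟩ := K.exists_measure_ne_zero_forall_le_of_prefix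
    (Metric.measure_closedBall_pos volume (0 : Fin nx → ℝ) hl).ne'
    (g := fun x σ t => ‖F.error P x 0 0 (K.walkNoise σ) t‖)
    (fun x t σ τ h => congrArg norm (F.error_walkNoise_congr P K h))
    fun x hx σ hσ => hbdd x hx _ hσ.isNoise
  obtain ⟨c, hc, hsep⟩ := exists_separated_image P.A
    (Metric.isBounded_closedBall.subset fun x hx => hx.1) hvol (R := 2 * M) (by positivity)
  obtain ⟨k₀, hk₀⟩ := K.exists_perronEigenvalue_pow_le_card_words
  set D := unstableDet P.A
  have hD : 0 < D := one_pos.trans_le (one_le_unstableDet P.A)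
  have hperron : 0 < K.perronEigenvalue := one_pos.trans_le K.one_le_perronEigenvalue
  have hcount : ∀ k : ℕ, c * D ^ (m + k₀) * (D * K.perronEigenvalue) ^ k ≤
      (Fintype.card X : ℝ) ^ (m + k₀) * Fintype.card X ^ k := by
    intro k
    obtain ⟨Q, hQ, hcard, hQsep⟩ := hsep (m + (k + k₀))
    have hle := F.card_mul_card_words_le P K hσ₀ (fun x hx => (hQ hx).2) hQsep
    calc c * D ^ (m + k₀) * (D * K.perronEigenvalue) ^ k
        = c * D ^ (m + (k + k₀)) * K.perronEigenvalue ^ k := by rw [mul_pow]; ring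
      _ ≤ Q.card * (K.words (σ₀ m) (k + k₀)).card :=
          mul_le_mul hcard (hk₀ _ _) (by positivity) (by positivity)
      _ ≤ (Fintype.card X : ℝ) ^ (m + (k + k₀)) := by exact_mod_cast hle
      _ = (Fintype.card X : ℝ) ^ (m + k₀) * Fintype.card X ^ k := by ring
  obtain ⟨k, hk⟩ := (eventually_mul_pow_lt_mul_pow (c := c * D ^ (m + k₀)) (Nat.cast_nonneg _)
    hrate (by positivity) ((Fintype.card X : ℝ) ^ (m + k₀))).exists
  exact hk.not_ge (hcount k)

end CoderEstimator

end Converse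

section BlockCode

theorem exists_enc_dec_add {G : Type*} [Fintype G] [Add G] [IsRightCancelAdd G] {W : Finset G}
    (hW : W.Nonempty) {μ : Type*} [Fintype μ] [Nonempty μ]
    (hμ : Fintype.card μ * W.card ^ 2 ≤ Fintype.card G) :
    ∃ (enc : μ → G) (dec : G → μ), ∀ m, ∀ w ∈ W, dec (enc m + w) = m := by
  obtain ⟨P, hcard, hP⟩ := exists_pairwise_add_ne_add hW hμ
  obtain ⟨e⟩ : Nonempty (μ ≃ P) := Fintype.card_eq.mp (by rw [Fintype.card_coe, hcard])
  let received : μ × W → G := fun p => e p.1 + p.2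
  have hfactor : (Prod.fst : μ × W → μ).FactorsThrough received := by
    rintro ⟨m, w, hw⟩ ⟨m', w', hw'⟩ h
    by_contra hne
    exact hP (e m).2 (e m').2 (fun h => hne (e.injective (Subtype.ext h))) w hw w' hw' h
  exact ⟨fun m => e m, Function.extend received Prod.fst fun _ => Classical.arbitrary μ,
    fun m w hw => hfactor.extend_apply _ (m, ⟨w, hw⟩)⟩

theorem AdditiveNoiseChannel.exists_zero_error_code {S X : Type*} [Fintype S] [Nonempty S]
    [Fintype X] [Add X] [IsRightCancelAdd X] (K : AdditiveNoiseChannel S X) {T : ℕ} {B : ℝ}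
    (hB : ∀ s, (K.words s T).card ≤ B) {μ : Type*} [Fintype μ] [Nonempty μ]
    (hμ : Fintype.card μ * (Fintype.card S * B) ^ 2 ≤ (Fintype.card X : ℝ) ^ T) :
    ∃ (enc : μ → Fin T → X) (dec : (Fin T → X) → μ),
      ∀ m s, ∀ w ∈ K.words s T, dec (enc m + w) = m := by
  classical
  let W : Finset (Fin T → X) := Finset.univ.biUnion fun s => K.words s T
  have hW : (W.card : ℝ) ≤ Fintype.card S * B := by
    calc (W.card : ℝ) ≤ ∑ s, ((K.words s T).card : ℝ) := by exact_mod_cast Finset.card_biUnion_le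
      _ ≤ Fintype.card S * B := by
          simpa using Finset.sum_le_card_nsmul Finset.univ _ B fun s _ => hB s
  have hcard : Fintype.card μ * W.card ^ 2 ≤ Fintype.card (Fin T → X) := by
    rw [Fintype.card_fun, Fintype.card_fin]
    exact_mod_cast (mul_le_mul_of_nonneg_left (pow_le_pow_left₀ (by positivity) hW 2)
      (Nat.cast_nonneg (Fintype.card μ))).trans hμ
  obtain ⟨enc, dec, h⟩ := exists_enc_dec_add
    (Finset.univ_nonempty.biUnion fun s _ => K.words_nonempty s T) hcard
  exact ⟨enc, dec, fun m s w hw =>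
    h m w (Finset.mem_biUnion.mpr ⟨s, Finset.mem_univ s, hw⟩)⟩

variable {n : Type*} [Fintype n] [DecidableEq n]

theorem exists_cover_image (A : Matrix n n ℝ) {θ : ℝ} (hθ : 1 < θ) :
    ∃ c : ℝ, ∀ k : ℕ, ∃ Q : Finset (n → ℝ), Q.card + 1 ≤ c * (θ * unstableDet A) ^ k ∧
      ∀ b : n → ℝ, ‖b‖ ≤ 1 → ∃ a : Q, ‖A ^ k *ᵥ b - a‖ ≤ 1 / 2 := by
  obtain ⟨c, hc, hcard⟩ := card_le_of_separated_image A hθ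
  refine ⟨c + 1, fun k => ?_⟩
  have hone : 1 ≤ (θ * unstableDet A) ^ k :=
    one_le_pow₀ (one_le_mul_of_one_le_of_one_le hθ.le (one_le_unstableDet A))
  set N : ℕ := ⌊c * (θ * unstableDet A) ^ k⌋₊ + 1
  rcases exists_pairwise_or_maximal (r := fun x y : n → ℝ => 1 / 2 < ‖x - y‖)
    (fun x y h => by rwa [norm_sub_rev]) (fun x => by simp)
    ((A ^ k *ᵥ ·) '' Metric.closedBall 0 1) N with ⟨Q, hQ, hQN, hsep⟩ | ⟨Q, -, hQN, hmax⟩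
  · exact absurd (hcard k Q hQ hsep) (hQN ▸ mod_cast (Nat.lt_floor_add_one _).not_ge)
  · refine ⟨Q, ?_, fun b hb => ?_⟩
    · have hfloor := Nat.floor_le (a := c * (θ * unstableDet A) ^ k) (by positivity)
      have hle : (Q.card : ℝ) + 1 ≤ ⌊c * (θ * unstableDet A) ^ k⌋₊ + 1 := by exact_mod_cast hQN
      linarith
    · obtain ⟨a, ha, hab⟩ := hmax _ ⟨b, by simpa using hb, rfl⟩
      exact ⟨⟨a, ha⟩, by simpa [norm_sub_rev] using hab⟩

variable {S X : Type*} [Fintype S]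

/-- A quantizer for `A ^ k` on the unit ball, with cells of half that size, together with a
zero-error code of block length `k` for its cells and one further symbol `none`, which will
signal that the quantized value lies outside the unit ball. -/
structure BlockCode [Add X] (A : Matrix n n ℝ) (K : AdditiveNoiseChannel S X) (k : ℕ) where
  centers : Finset (n → ℝ)
  enc : Option centers → Fin k → X
  dec : (Fin k → X) → Option centers
  exists_norm_sub_le : ∀ b : n → ℝ, ‖b‖ ≤ 1 → ∃ a : centers, ‖A ^ k *ᵥ b - a‖ ≤ 1 / 2
  dec_enc_add : ∀ m s, ∀ w ∈ K.words s k, dec (enc m + w) = m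

theorem eventually_nonempty_blockCode [DecidableEq S] [Nonempty S] [Fintype X] [Add X]
    [IsRightCancelAdd X] (A : Matrix n n ℝ) (K : AdditiveNoiseChannel S X)
    (hrate : unstableDet A * K.perronEigenvalue ^ 2 < Fintype.card X) :
    ∀ᶠ k in atTop, Nonempty (BlockCode A K k) := by
  set D := unstableDet A
  set p := K.perronEigenvalue
  have hD : 0 < D := one_pos.trans_le (one_le_unstableDet A)
  have hp : 0 < p := one_pos.trans_le K.one_le_perronEigenvalue
  have hDp : 0 < D * p ^ 2 := by positivity
  obtain ⟨θ, hθ, hθ4⟩ := exists_one_lt_pow_le ((one_lt_div hDp).mpr hrate) 4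
  have hgap : θ ^ 3 * (D * p ^ 2) < Fintype.card X :=
    (mul_lt_mul_of_pos_right (pow_lt_pow_right₀ hθ (by norm_num)) hDp).trans_le
      ((le_div_iff₀ hDp).mp hθ4)
  obtain ⟨c₁, hcover⟩ := exists_cover_image A hθ
  obtain ⟨c₂, hc₂, hwords⟩ := K.exists_card_words_le hθ
  filter_upwards [eventually_mul_pow_lt_mul_pow (by positivity) hgap one_pos
    (c₁ * (Fintype.card S * c₂) ^ 2)] with k hk
  obtain ⟨Q, hQ, hcell⟩ := hcover k
  have hbudget : Fintype.card (Option Q) * (Fintype.card S * (c₂ * (θ * p) ^ k)) ^ 2 ≤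
      (Fintype.card X : ℝ) ^ k := by
    rw [Fintype.card_option, Fintype.card_coe, Nat.cast_succ]
    calc (Q.card + 1) * (Fintype.card S * (c₂ * (θ * p) ^ k)) ^ 2
        ≤ c₁ * (θ * D) ^ k * (Fintype.card S * (c₂ * (θ * p) ^ k)) ^ 2 := by gcongr
      _ = c₁ * (Fintype.card S * c₂) ^ 2 * (θ ^ 3 * (D * p ^ 2)) ^ k := by
          simp only [mul_pow, ← pow_mul]
          ring
      _ ≤ (Fintype.card X : ℝ) ^ k := hk.le.trans_eq (one_mul _)
  obtain ⟨enc, dec, hdec⟩ := K.exists_zero_error_code (fun s => hwords s k) hbudget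
  exact ⟨⟨Q, enc, dec, hcell, hdec⟩⟩

end BlockCode

section ZoomingQuantizer

variable {n : Type*} [Fintype n] {α : Type*} (B : Matrix n n ℝ) (a : α → n → ℝ)

/-- Zoom factor of the quantizer: its scale is multiplied by `zoom B` after each overflow. It
exceeds the expansion `‖B‖` by more than a factor `2`, so that the scale catches up with the
error. -/
def zoom : ℝ := 2 * (‖B‖ + 1)

/-- State update of the zooming quantizer. A state `(c, j)` consists of the predicted value `c` and
the number `j` of overflows so far; `some i` announces the cell of `a i` and `none` an overflow. -/
def quantizerStep (s : (n → ℝ) × ℕ) : Option α → (n → ℝ) × ℕ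
  | some i => (B *ᵥ s.1 + zoom B ^ s.2 • a i, s.2)
  | none => (B *ᵥ s.1, s.2 + 1)

open Classical in
/-- The symbol emitted by the zooming quantizer in state `s` for the value `ξ`: a cell containing
the prediction error propagated by `B`, if there is one. -/
def quantize (s : (n → ℝ) × ℕ) (ξ : n → ℝ) : Option α :=
  if h : ∃ i, ‖B *ᵥ (ξ - s.1) - zoom B ^ s.2 • a i‖ ≤ zoom B ^ s.2 / 2 then some h.choose else none

/-- Quantizer state of the estimator after the first `k` symbols of `m`. -/
def decoderState (m : ℕ → Option α) : ℕ → (n → ℝ) × ℕ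
  | 0 => (0, 0)
  | k + 1 => quantizerStep B a (decoderState m k) (m k)

/-- Quantizer state of the coder before it processes `ξ k`. -/
def encoderState (ξ : ℕ → n → ℝ) : ℕ → (n → ℝ) × ℕ
  | 0 => (0, 0)
  | k + 1 => quantizerStep B a (encoderState ξ k) (quantize B a (encoderState ξ k) (ξ k))

/-- The symbol that the coder emits for `ξ k`. -/
def quantizerSymbol (ξ : ℕ → n → ℝ) (k : ℕ) : Option α :=
  quantize B a (encoderState B a ξ k) (ξ k)

theorem encoderState_congr {ξ ξ' : ℕ → n → ℝ} {k : ℕ} (h : ∀ i < k, ξ i = ξ' i) :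
    encoderState B a ξ k = encoderState B a ξ' k := by
  induction k with
  | zero => rfl
  | succ k ih =>
    rw [encoderState, encoderState, ih fun i hi => h i (hi.trans k.lt_succ_self),
      h k k.lt_succ_self]

theorem quantizerSymbol_congr {ξ ξ' : ℕ → n → ℝ} {k : ℕ} (h : ∀ i ≤ k, ξ i = ξ' i) :
    quantizerSymbol B a ξ k = quantizerSymbol B a ξ' k := by
  rw [quantizerSymbol, quantizerSymbol, encoderState_congr B a fun i hi => h i hi.le, h k le_rfl]

theorem decoderState_eq_encoderState {m : ℕ → Option α} {ξ : ℕ → n → ℝ} {k : ℕ}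
    (h : ∀ i < k, m i = quantizerSymbol B a ξ i) :
    decoderState B a m k = encoderState B a ξ k := by
  induction k with
  | zero => rfl
  | succ k ih =>
    rw [encoderState, decoderState, ih fun i hi => h i (hi.trans k.lt_succ_self),
      h k k.lt_succ_self, quantizerSymbol]

/-- Bound on the prediction error of the zooming quantizer after `j` overflows when the quantized
sequence follows `B` up to errors of size `D`. -/
def predictionBound (D : ℝ) (j : ℕ) : ℝ := zoom B ^ j / 2 + D * (‖B‖ + 1) ^ j

variable {B a}

theorem zoom_pos : 0 < zoom B := by
  unfold zoom
  positivity

theorem one_le_zoom : 1 ≤ zoom B := by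
  unfold zoom
  linarith [norm_nonneg B]

theorem predictionBound_mono {D : ℝ} (hD : 0 ≤ D) : Monotone (predictionBound B D) := by
  intro i j hij
  have hB : 1 ≤ ‖B‖ + 1 := by linarith [norm_nonneg B]
  have hzoom : 1 ≤ zoom B := one_le_zoom
  unfold predictionBound
  gcongr

theorem norm_sub_le_of_quantize_eq_some {s : (n → ℝ) × ℕ} {ξ : n → ℝ} {i : α}
    (h : quantize B a s ξ = some i) :
    ‖B *ᵥ (ξ - s.1) - zoom B ^ s.2 • a i‖ ≤ zoom B ^ s.2 / 2 := by
  unfold quantize at h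
  split_ifs at h with hex
  exact Option.some_injective _ h ▸ hex.choose_spec

theorem zoom_pow_lt_of_quantize_eq_none
    (ha : ∀ b : n → ℝ, ‖b‖ ≤ 1 → ∃ i, ‖B *ᵥ b - a i‖ ≤ 1 / 2) {s : (n → ℝ) × ℕ} {ξ : n → ℝ}
    (h : quantize B a s ξ = none) : zoom B ^ s.2 < ‖ξ - s.1‖ := by
  by_contra! hle
  set L := zoom B ^ s.2
  have hL : 0 < L := pow_pos zoom_pos _
  obtain ⟨i, hi⟩ := ha (L⁻¹ • (ξ - s.1)) (by
    rwa [norm_smul, norm_inv, Real.norm_of_nonneg hL.le, inv_mul_le_one₀ hL])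
  have hscale : B *ᵥ (ξ - s.1) - L • a i = L • (B *ᵥ (L⁻¹ • (ξ - s.1)) - a i) := by
    rw [Matrix.mulVec_smul, smul_sub, smul_inv_smul₀ hL.ne']
  unfold quantize at h
  split_ifs at h with hex
  refine hex ⟨i, ?_⟩
  rw [hscale, norm_smul, Real.norm_of_nonneg hL.le, div_eq_mul_one_div L 2]
  exact mul_le_mul_of_nonneg_left hi hL.le

section Step

variable {D : ℝ} {s : (n → ℝ) × ℕ} {ξ ξ' : n → ℝ}

theorem norm_sub_quantizerStep_le (hs : ‖ξ - s.1‖ ≤ predictionBound B D s.2)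
    (hξ : ‖ξ' - B *ᵥ ξ‖ ≤ D) :
    ‖ξ' - (quantizerStep B a s (quantize B a s ξ)).1‖ ≤
      predictionBound B D (quantizerStep B a s (quantize B a s ξ)).2 := by
  have hDg : D ≤ D * (‖B‖ + 1) ^ s.2 := le_mul_of_one_le_right ((norm_nonneg _).trans hξ)
    (one_le_pow₀ (by linarith [norm_nonneg B]))
  rcases hsymbol : quantize B a s ξ with _ | i
  · have hsplit : ξ' - B *ᵥ s.1 = (ξ' - B *ᵥ ξ) + B *ᵥ (ξ - s.1) := by
      rw [Matrix.mulVec_sub]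
      abel
    calc ‖ξ' - B *ᵥ s.1‖ ≤ D + ‖B‖ * predictionBound B D s.2 := by
          rw [hsplit]
          exact norm_add_le_of_le hξ ((Matrix.linfty_opNorm_mulVec _ _).trans
            (mul_le_mul_of_nonneg_left hs (norm_nonneg B)))
      _ = zoom B ^ s.2 * ‖B‖ / 2 + (D + D * (‖B‖ + 1) ^ s.2 * ‖B‖) := by
          unfold predictionBound
          ring
      _ ≤ zoom B ^ s.2 * zoom B / 2 + (D * (‖B‖ + 1) ^ s.2 + D * (‖B‖ + 1) ^ s.2 * ‖B‖) := by
          have hpow : 0 ≤ zoom B ^ s.2 := pow_nonneg zoom_pos.le _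
          gcongr
          unfold zoom
          linarith [norm_nonneg B]
      _ = predictionBound B D (s.2 + 1) := by
          unfold predictionBound
          ring
  · have hsplit : ξ' - (B *ᵥ s.1 + zoom B ^ s.2 • a i) =
        (B *ᵥ (ξ - s.1) - zoom B ^ s.2 • a i) + (ξ' - B *ᵥ ξ) := by
      rw [Matrix.mulVec_sub]
      abel
    calc ‖ξ' - (B *ᵥ s.1 + zoom B ^ s.2 • a i)‖ ≤ zoom B ^ s.2 / 2 + D := by
          rw [hsplit]
          exact norm_add_le_of_le (norm_sub_le_of_quantize_eq_some hsymbol) hξ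
      _ ≤ predictionBound B D s.2 := add_le_add_right hDg _

-- The scale outgrows the prediction error, which leaves room for finitely many overflows only.
theorem two_pow_lt_of_quantize_eq_none
    (ha : ∀ b : n → ℝ, ‖b‖ ≤ 1 → ∃ i, ‖B *ᵥ b - a i‖ ≤ 1 / 2)
    (hs : ‖ξ - s.1‖ ≤ predictionBound B D s.2) (h : quantize B a s ξ = none) :
    2 ^ s.2 < 2 * D := by
  have hlt := (zoom_pow_lt_of_quantize_eq_none ha h).trans_le hs
  rw [predictionBound, zoom, mul_pow] at hlt
  have hpos : 0 < (‖B‖ + 1) ^ s.2 := by positivity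
  refine lt_of_mul_lt_mul_right ?_ hpos.le
  linarith

end Step

theorem exists_norm_sub_encoderState_le
    (ha : ∀ b : n → ℝ, ‖b‖ ≤ 1 → ∃ i, ‖B *ᵥ b - a i‖ ≤ 1 / 2) (D : ℝ) :
    ∃ E : ℝ, ∀ ξ : ℕ → n → ℝ, ‖ξ 0‖ ≤ D → (∀ k, ‖ξ (k + 1) - B *ᵥ ξ k‖ ≤ D) →
      ∀ k, ‖ξ k - (encoderState B a ξ k).1‖ ≤ E := by
  obtain ⟨J, hJ⟩ := pow_unbounded_of_one_lt (2 * D) (one_lt_two (α := ℝ))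
  refine ⟨predictionBound B D J, fun ξ h0 hξ => ?_⟩
  have hbound : ∀ k, ‖ξ k - (encoderState B a ξ k).1‖ ≤
      predictionBound B D (encoderState B a ξ k).2 := by
    intro k
    induction k with
    | zero =>
      simp only [encoderState, predictionBound, sub_zero, pow_zero, mul_one]
      linarith
    | succ k ih => exact norm_sub_quantizerStep_le ih (hξ k)
  have hoverflows : ∀ k, (encoderState B a ξ k).2 ≤ J := by
    intro k
    induction k with
    | zero => exact J.zero_le
    | succ k ih =>
      rw [encoderState]
      rcases hsymbol : quantize B a (encoderState B a ξ k) (ξ k) with _ | i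
      · have hlt := (two_pow_lt_of_quantize_eq_none ha (hbound k) hsymbol).trans hJ
        exact (pow_lt_pow_iff_right₀ one_lt_two).mp hlt
      · exact ih
  exact fun k => (hbound k).trans (predictionBound_mono ((norm_nonneg _).trans h0) (hoverflows k))

end ZoomingQuantizer

section Observer

namespace LTISystem

variable {nx ny N : ℕ} (P : LTISystem nx ny)

/-- `g` recovers the initial state from the first `N` undisturbed outputs. -/
def IsReconstruction (g : (Fin N → Fin ny → ℝ) →L[ℝ] (Fin nx → ℝ)) : Prop :=
  ∀ x, g (fun i => P.C *ᵥ (P.A ^ (i : ℕ) *ᵥ x)) = x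

/-- The initial states whose first `N` undisturbed outputs vanish. -/
def unobservableSubspace (N : ℕ) : Submodule ℝ (Fin nx → ℝ) :=
  ⨅ i : Fin N, LinearMap.ker (P.C * P.A ^ (i : ℕ)).mulVecLin

variable {P}

theorem mem_unobservableSubspace {x : Fin nx → ℝ} :
    x ∈ P.unobservableSubspace N ↔ ∀ i : ℕ, i < N → P.C *ᵥ (P.A ^ i *ᵥ x) = 0 := by
  simp [unobservableSubspace, Fin.forall_iff, Matrix.mulVec_mulVec]

theorem unobservableSubspace_antitone : Antitone P.unobservableSubspace := fun _ _ hN _ hx =>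
  mem_unobservableSubspace.mpr fun i hi => mem_unobservableSubspace.mp hx i (hi.trans_le hN)

theorem Observable.exists_unobservableSubspace_eq_bot (h : P.Observable) :
    ∃ N, P.unobservableSubspace N = ⊥ := by
  obtain ⟨N, hN⟩ := IsArtinian.monotone_stabilizes
    (⟨OrderDual.toDual ∘ P.unobservableSubspace, unobservableSubspace_antitone.dual_right⟩ :
      ℕ →o (Submodule ℝ (Fin nx → ℝ))ᵒᵈ)
  have hstable : ∀ m, N ≤ m → P.unobservableSubspace N = P.unobservableSubspace m := hN
  refine ⟨N, (Submodule.eq_bot_iff _).mpr fun x hx => h x fun k => ?_⟩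
  rw [hstable (max N (k + 1)) (le_max_left _ _)] at hx
  exact mem_unobservableSubspace.mp hx k (Nat.lt_of_succ_le (le_max_right _ _))

theorem Observable.exists_isReconstruction (h : P.Observable) :
    ∃ (N : ℕ) (g : (Fin N → Fin ny → ℝ) →L[ℝ] (Fin nx → ℝ)), P.IsReconstruction g := by
  obtain ⟨N, hN⟩ := h.exists_unobservableSubspace_eq_bot
  let outputs : (Fin nx → ℝ) →ₗ[ℝ] (Fin N → Fin ny → ℝ) :=
    LinearMap.pi fun i => (P.C * P.A ^ (i : ℕ)).mulVecLin
  have hker : LinearMap.ker outputs = ⊥ := by rw [LinearMap.ker_pi]; exact hN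
  obtain ⟨g, hg⟩ := outputs.exists_leftInverse_of_injective hker
  refine ⟨N, LinearMap.toContinuousLinearMap g, fun x => ?_⟩
  simpa [outputs, LinearMap.pi, ← Matrix.mulVec_mulVec] using LinearMap.congr_fun hg x

variable (P)

theorem norm_state_add_sub_le {x₀ : Fin nx → ℝ} {v : ℕ → Fin nx → ℝ} {b : ℝ}
    (hv : ∀ t, ‖v t‖ ≤ b) (t i : ℕ) :
    ‖P.state x₀ v (t + i) - P.A ^ i *ᵥ P.state x₀ v t‖ ≤ b * ∑ j ∈ Finset.range i, ‖P.A‖ ^ j := by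
  induction i with
  | zero => simp
  | succ i ih =>
    have hstep : P.state x₀ v (t + (i + 1)) - P.A ^ (i + 1) *ᵥ P.state x₀ v t =
        P.A *ᵥ (P.state x₀ v (t + i) - P.A ^ i *ᵥ P.state x₀ v t) + v (t + i) := by
      rw [← add_assoc, LTISystem.state, Matrix.mulVec_sub, Matrix.mulVec_mulVec, ← pow_succ']
      abel
    calc _ ≤ ‖P.A‖ * (b * ∑ j ∈ Finset.range i, ‖P.A‖ ^ j) + b := by
          rw [hstep]
          exact norm_add_le_of_le ((Matrix.linfty_opNorm_mulVec _ _).trans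
            (mul_le_mul_of_nonneg_left ih (norm_nonneg _))) (hv _)
      _ = b * ∑ j ∈ Finset.range (i + 1), ‖P.A‖ ^ j := by
          simp only [Finset.sum_range_succ', pow_succ', ← Finset.mul_sum, pow_zero]
          ring

theorem exists_norm_state_add_sub_le (b : ℝ) (m : ℕ) :
    ∃ β : ℝ, ∀ x₀ v, (∀ t, ‖v t‖ ≤ b) → ∀ t, ∀ i ≤ m,
      ‖P.state x₀ v (t + i) - P.A ^ i *ᵥ P.state x₀ v t‖ ≤ β := by
  refine ⟨b * ∑ j ∈ Finset.range m, ‖P.A‖ ^ j, fun x₀ v hv t i hi =>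
    (P.norm_state_add_sub_le hv t i).trans ?_⟩
  have hb : 0 ≤ b := (norm_nonneg _).trans (hv 0)
  gcongr

variable {P}

theorem IsReconstruction.exists_norm_sub_state_le {g : (Fin N → Fin ny → ℝ) →L[ℝ] (Fin nx → ℝ)}
    (hg : P.IsReconstruction g) (b b' : ℝ) :
    ∃ ε : ℝ, ∀ x₀ v w, (∀ t, ‖v t‖ ≤ b) → (∀ t, ‖w t‖ ≤ b') →
      ∀ t, ‖g (fun i => P.output x₀ v w (t + i)) - P.state x₀ v t‖ ≤ ε := by
  obtain ⟨β, hβ⟩ := P.exists_norm_state_add_sub_le b N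
  refine ⟨‖g‖ * (‖P.C‖ * β + b'), fun x₀ v w hv hw t => ?_⟩
  have hdisturbance : ∀ i : Fin N,
      ‖P.output x₀ v w (t + i) - P.C *ᵥ (P.A ^ (i : ℕ) *ᵥ P.state x₀ v t)‖ ≤ ‖P.C‖ * β + b' := by
    intro i
    rw [LTISystem.output, add_sub_right_comm, ← Matrix.mulVec_sub]
    exact norm_add_le_of_le ((Matrix.linfty_opNorm_mulVec _ _).trans
      (mul_le_mul_of_nonneg_left (hβ x₀ v hv t i i.2.le) (norm_nonneg _))) (hw _)
  have hβ0 : 0 ≤ β := (norm_nonneg _).trans (hβ x₀ v hv 0 0 N.zero_le)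
  have hb'0 : 0 ≤ b' := (norm_nonneg _).trans (hw 0)
  rw [← hg (P.state x₀ v t), ← map_sub]
  exact (g.le_opNorm _).trans (mul_le_mul_of_nonneg_left
    ((pi_norm_le_iff_of_nonneg (by positivity)).mpr hdisturbance) (norm_nonneg _))

end LTISystem

end Observer

section BlockScheme

variable {nx ny N k : ℕ} {S X : Type*} [Fintype S] [Add X]

/-- The reconstructions of the states at times `0, k, 2 * k, …` from the outputs `y`. -/
def blockObservation (k : ℕ) (g : (Fin N → Fin ny → ℝ) →L[ℝ] (Fin nx → ℝ))
    (y : ℕ → Fin ny → ℝ) (j : ℕ) : Fin nx → ℝ :=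
  g fun i => y (j * k + i)

/-- In block `j + 1` the coder sends the quantizer symbol for the observed state at the start of
block `j`, protected by `Q.enc`; the estimator propagates the latest decoded prediction by `A`.
Data that are not yet available are replaced by arbitrary values. In block `0` the truncated
subtraction makes the coder send symbol `0`, which is never decoded. -/
def blockScheme [Nonempty X] {A : Matrix (Fin nx) (Fin nx) ℝ} {K : AdditiveNoiseChannel S X}
    (Q : BlockCode A K k) (hk : 0 < k) (g : (Fin N → Fin ny → ℝ) →L[ℝ] (Fin nx → ℝ)) :
    CoderEstimator nx ny X where
  coder t y :=
    Q.enc (quantizerSymbol (A ^ k) Subtype.val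
      (blockObservation k g (Function.extend Fin.val y 0)) (t / k - 1)) ⟨t % k, Nat.mod_lt t hk⟩
  estimator t r :=
    let received := Function.extend Fin.val r fun _ => Classical.arbitrary X
    A ^ (t + 1 - ((t + 1) / k - 1) * k) *ᵥ
      (decoderState (A ^ k) Subtype.val
        (fun j => Q.dec fun i => received ((j + 1) * k + i)) ((t + 1) / k - 1)).1

theorem extend_val_apply {E : Type*} {m i : ℕ} (h : i < m) (y e : ℕ → E) :
    Function.extend Fin.val (fun j : Fin m => y j) e i = y i :=
  Fin.val_injective.extend_apply (fun j : Fin m => y j) e ⟨i, h⟩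

theorem lt_div_sub_one_mul_add (hk : 0 < k) (t : ℕ) : t < (t / k - 1) * k + 2 * k := by
  have hlt : t < t / k * k + k := Nat.lt_div_mul_add hk
  have hle : t / k * k ≤ (t / k - 1 + 1) * k := Nat.mul_le_mul_right k (by omega)
  linarith

section CodingProperties

variable [Nonempty X] {A : Matrix (Fin nx) (Fin nx) ℝ} {K : AdditiveNoiseChannel S X}
  (Q : BlockCode A K k) (hk : 0 < k) {g : (Fin N → Fin ny → ℝ) →L[ℝ] (Fin nx → ℝ)}

theorem blockScheme_channelInput (hN : N ≤ k) (y : ℕ → Fin ny → ℝ) (j : ℕ) (i : Fin k) :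
    (blockScheme Q hk g).channelInput y ((j + 1) * k + i) =
      Q.enc (quantizerSymbol (A ^ k) Subtype.val
        (blockObservation k g y) j) i := by
  have hdiv : ((j + 1) * k + i) / k - 1 = j := by
    rw [add_comm, Nat.add_mul_div_right _ _ hk, Nat.div_eq_of_lt i.2]
    omega
  have hmod : ((j + 1) * k + i) % k = i := by
    rw [add_comm, Nat.add_mul_mod_self_right, Nat.mod_eq_of_lt i.2]
  have hobserved : ∀ l ≤ j, blockObservation k g
      (Function.extend Fin.val (fun i' : Fin ((j + 1) * k + i + 1) => y i') 0) l =
        blockObservation k g y l := by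
    intro l hl
    refine congrArg g (funext fun m => extend_val_apply ?_ y 0)
    have hlk : l * k ≤ j * k := Nat.mul_le_mul_right k hl
    have hm := m.2
    linarith
  simp only [CoderEstimator.channelInput, blockScheme, hdiv, hmod,
    quantizerSymbol_congr _ _ hobserved]

theorem dec_channelOutput (hN : N ≤ k) (y : ℕ → Fin ny → ℝ) {z : ℕ → X} (hz : K.IsNoise z)
    (j : ℕ) :
    Q.dec (fun i => (blockScheme Q hk g).channelOutput y z ((j + 1) * k + i)) =
      quantizerSymbol (A ^ k) Subtype.val (blockObservation k g y) j := by
  obtain ⟨σ, hσ⟩ := hz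
  have hwalk : K.IsWalk σ := fun t => (hσ t).1
  have hw : (fun i : Fin k => z ((j + 1) * k + i)) ∈ K.words (σ ((j + 1) * k)) k := by
    refine AdditiveNoiseChannel.mem_words.mpr ⟨_, hwalk.shift ((j + 1) * k), by simp, fun i => ?_⟩
    rw [(hσ _).2, AdditiveNoiseChannel.walkNoise, add_right_comm _ 1, add_comm]
  refine Eq.trans (congrArg Q.dec (funext fun i => ?_)) (Q.dec_enc_add _ _ _ hw)
  rw [CoderEstimator.channelOutput, blockScheme_channelInput Q hk hN, Pi.add_apply]

theorem blockScheme_estimate (hN : N ≤ k) (y : ℕ → Fin ny → ℝ) {z : ℕ → X} (hz : K.IsNoise z)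
    (t : ℕ) :
    (blockScheme Q hk g).estimate ((blockScheme Q hk g).channelOutput y z) t =
      A ^ (t - (t / k - 1) * k) *ᵥ (encoderState (A ^ k)
        (Subtype.val : Q.centers → _) (blockObservation k g y) (t / k - 1)).1 := by
  cases t with
  | zero => simp [CoderEstimator.estimate, encoderState]
  | succ t =>
    refine congrArg (A ^ (t + 1 - ((t + 1) / k - 1) * k) *ᵥ ·.1)
      (decoderState_eq_encoderState _ _ fun j hj => ?_)
    rw [← dec_channelOutput Q hk hN y hz]
    refine congrArg Q.dec (funext fun i => extend_val_apply ?_ _ _)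
    have hblock : (j + 2) * k ≤ t + 1 :=
      (Nat.mul_le_mul_right k (by omega)).trans (Nat.div_mul_le_self (t + 1) k)
    have hi := i.2
    linarith

end CodingProperties

theorem norm_sub_mulVec_le {m n : Type*} [Fintype m] [Fintype n] {B : Matrix m n ℝ}
    {x c : n → ℝ} {x' : m → ℝ} {β δ : ℝ} (hx : ‖x' - B *ᵥ x‖ ≤ β) (hc : ‖x - c‖ ≤ δ) :
    ‖x' - B *ᵥ c‖ ≤ β + ‖B‖ * δ := by
  have hsplit : x' - B *ᵥ c = (x' - B *ᵥ x) + B *ᵥ (x - c) := by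
    rw [Matrix.mulVec_sub, sub_add_sub_cancel]
  rw [hsplit]
  exact norm_add_le_of_le hx ((Matrix.linfty_opNorm_mulVec _ _).trans
    (mul_le_mul_of_nonneg_left hc (norm_nonneg B)))

variable {P : LTISystem nx ny}

theorem exists_norm_blockObservation_sub_encoderState_le {α : Type*} {a : α → Fin nx → ℝ}
    (ha : ∀ b : Fin nx → ℝ, ‖b‖ ≤ 1 → ∃ i, ‖P.A ^ k *ᵥ b - a i‖ ≤ 1 / 2)
    {g : (Fin N → Fin ny → ℝ) →L[ℝ] (Fin nx → ℝ)} (hg : P.IsReconstruction g) (l b b' : ℝ) :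
    ∃ δ : ℝ, ∀ x₀ v w, ‖x₀‖ ≤ l → (∀ t, ‖v t‖ ≤ b) → (∀ t, ‖w t‖ ≤ b') → ∀ j,
      ‖P.state x₀ v (j * k) -
        (encoderState (P.A ^ k) a (blockObservation k g (P.output x₀ v w)) j).1‖ ≤ δ := by
  obtain ⟨ε, hε⟩ := hg.exists_norm_sub_state_le b b'
  obtain ⟨β, hβ⟩ := P.exists_norm_state_add_sub_le b k
  obtain ⟨E, hE⟩ :=
    exists_norm_sub_encoderState_le ha (max (ε + l) (ε + (β + ‖P.A ^ k‖ * ε)))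
  refine ⟨ε + E, fun x₀ v w hx₀ hv hw j => ?_⟩
  set ξ := blockObservation k g (P.output x₀ v w)
  have hobs : ∀ j, ‖ξ j - P.state x₀ v (j * k)‖ ≤ ε := fun j => hε x₀ v w hv hw (j * k)
  have hobs' : ∀ j, ‖P.state x₀ v (j * k) - ξ j‖ ≤ ε := fun j => by
    rw [norm_sub_rev]
    exact hobs j
  have hinit : ‖ξ 0‖ ≤ ε + l := by
    have hξ := hobs 0
    rw [zero_mul, LTISystem.state] at hξ
    rw [← sub_add_cancel (ξ 0) x₀]
    exact norm_add_le_of_le hξ hx₀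
  have hstep : ∀ j, ‖ξ (j + 1) - P.A ^ k *ᵥ ξ j‖ ≤ ε + (β + ‖P.A ^ k‖ * ε) := fun j => by
    have hdrift := hβ x₀ v hv (j * k) k le_rfl
    rw [← Nat.succ_mul] at hdrift
    rw [← sub_add_sub_cancel (ξ (j + 1)) (P.state x₀ v ((j + 1) * k))]
    exact norm_add_le_of_le (hobs (j + 1)) (norm_sub_mulVec_le hdrift (hobs' j))
  rw [← sub_add_sub_cancel _ (ξ j)]
  exact norm_add_le_of_le (hobs' j)
    (hE ξ (hinit.trans (le_max_left _ _)) (fun j => (hstep j).trans (le_max_right _ _)) j)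

theorem blockScheme_uniformlyBounded [Nonempty X] {K : AdditiveNoiseChannel S X}
    (Q : BlockCode P.A K k) (hk : 0 < k) {g : (Fin N → Fin ny → ℝ) →L[ℝ] (Fin nx → ℝ)}
    (hN : N ≤ k) (hg : P.IsReconstruction g) : (blockScheme Q hk g).UniformlyBounded P K := by
  rintro 𝒱 𝒲 ⟨-, b, hb⟩ ⟨-, b', hb'⟩
  obtain ⟨δ, hδ⟩ :=
    exists_norm_blockObservation_sub_encoderState_le Q.exists_norm_sub_le hg 1 b b'
  obtain ⟨β, hβ⟩ := P.exists_norm_state_add_sub_le b (2 * k)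
  obtain ⟨ρ, hρ⟩ := ((Set.finite_Iic (2 * k)).image fun s => ‖P.A ^ s‖).bddAbove
  refine ⟨1, one_pos, fun R₀ hR₀ => ⟨β + ρ * δ, fun x₀ hx₀ v hv w hw z hz t => ?_⟩⟩
  set start := (t / k - 1) * k
  have hstart : start ≤ t :=
    (Nat.mul_le_mul_right k (Nat.sub_le _ _)).trans (Nat.div_mul_le_self t k)
  have helapsed : t - start ≤ 2 * k := by
    have := lt_div_sub_one_mul_add hk t
    omega
  have hdrift := hβ x₀ v (hb v hv) start (t - start) helapsed
  have hpredict := hδ x₀ v w (mem_closedBall_zero_iff.mp (hR₀ hx₀)) (hb v hv) (hb' w hw) (t / k - 1)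
  rw [Nat.add_sub_of_le hstart] at hdrift
  rw [CoderEstimator.error, blockScheme_estimate Q hk hN _ hz]
  refine (norm_sub_mulVec_le hdrift hpredict).trans ?_
  gcongr
  · exact (norm_nonneg _).trans hpredict
  · exact hρ (Set.mem_image_of_mem _ helapsed)

theorem exists_uniformlyBounded [DecidableEq S] [Nonempty S] [Fintype X] [Nonempty X]
    [IsRightCancelAdd X] (K : AdditiveNoiseChannel S X) (hobs : P.Observable)
    (hrate : unstableDet P.A * K.perronEigenvalue ^ 2 < Fintype.card X) :
    ∃ F : CoderEstimator nx ny X, F.UniformlyBounded P K := by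
  obtain ⟨N, g, hg⟩ := hobs.exists_isReconstruction
  obtain ⟨k, ⟨Q⟩, hN, hk⟩ := ((eventually_nonempty_blockCode P.A K hrate).and
    ((eventually_ge_atTop N).and (eventually_gt_atTop 0))).exists
  exact ⟨blockScheme Q hk g, blockScheme_uniformlyBounded Q hk hN hg⟩

end BlockScheme

section Rates

variable {nx ny : ℕ} {S X : Type*} [Fintype S] [DecidableEq S] [Nonempty S] [Fintype X]
  [Nontrivial X] {P : LTISystem nx ny} {K : AdditiveNoiseChannel S X}

theorem unstableDet_mul_perronEigenvalue_sq_lt_card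
    (h : P.entropy (Fintype.card X) + 2 * K.entropy < 1) :
    unstableDet P.A * K.perronEigenvalue ^ 2 < Fintype.card X := by
  have hq : 1 < Fintype.card X := Fintype.one_lt_card
  have hq₀ : (0 : ℝ) < Fintype.card X := by positivity
  rw [← P.rpow_entropy hq, ← K.rpow_entropy, ← Real.rpow_mul_natCast hq₀.le,
    ← Real.rpow_add hq₀]
  refine Real.rpow_lt_self_of_one_lt (mod_cast hq) ?_
  push_cast
  linarith

theorem card_lt_unstableDet_mul_perronEigenvalue
    (h : 1 < P.entropy (Fintype.card X) + K.entropy) :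
    Fintype.card X < unstableDet P.A * K.perronEigenvalue := by
  have hq : 1 < Fintype.card X := Fintype.one_lt_card
  have hq₀ : (0 : ℝ) < Fintype.card X := by positivity
  rw [← P.rpow_entropy hq, ← K.rpow_entropy, ← Real.rpow_add hq₀]
  exact Real.self_lt_rpow_of_one_lt (mod_cast hq) h

end Rates

end FSEstimation

end

theorem proposition3_general {nx ny : ℕ} {S X : Type*} [Fintype S] [DecidableEq S] [Nonempty S]
    [Fintype X] [Nontrivial X] [Add X] [IsCancelAdd X]
    (P : FSEstimation.LTISystem nx ny) (K : FSEstimation.AdditiveNoiseChannel S X) :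
    (P.Observable → P.entropy (Fintype.card X) + 2 * K.entropy < 1 →
      ∃ F : FSEstimation.CoderEstimator nx ny X, F.UniformlyBounded P K) ∧
    (1 < P.entropy (Fintype.card X) + K.entropy →
      ∀ (F : FSEstimation.CoderEstimator nx ny X)
        (𝒱 : Set (ℕ → Fin nx → ℝ)) (𝒲 : Set (ℕ → Fin ny → ℝ)),
        FSEstimation.AdmissibleRange 𝒱 → FSEstimation.AdmissibleRange 𝒲 →
        ∀ l : ℝ, 0 < l →
          ∃ v ∈ 𝒱, ∃ w ∈ 𝒲, ∃ x₀ ∈ Metric.closedBall (0 : Fin nx → ℝ) l,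
            ∃ z : ℕ → X, K.IsNoise z ∧ ∀ M : ℝ, ∃ t, M < ‖F.error P x₀ v w z t‖) :=
  ⟨fun hobs h => FSEstimation.exists_uniformlyBounded K hobs
      (FSEstimation.unstableDet_mul_perronEigenvalue_sq_lt_card h),
    fun h F _ _ h𝒱 h𝒲 _ hl => ⟨0, h𝒱.1, 0, h𝒲.1, F.exists_unbounded_error P K
      (FSEstimation.card_lt_unstableDet_mul_perronEigenvalue h) hl⟩⟩

theorem proposition3 {nx ny : ℕ} {S X : Type*} [Fintype S] [DecidableEq S] [Nonempty S]
    [Fintype X] [Nontrivial X] [AddCommGroup X]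
    (P : FSEstimation.LTISystem nx ny) (K : FSEstimation.AdditiveNoiseChannel S X)
    (hobs : P.Observable) (hunst : P.HasUnstableEigenvalue) :
    (P.entropy (Fintype.card X) + 2 * K.entropy < 1 →
      ∃ F : FSEstimation.CoderEstimator nx ny X, F.UniformlyBounded P K) ∧
    (1 < P.entropy (Fintype.card X) + K.entropy →
      ∀ (F : FSEstimation.CoderEstimator nx ny X)
        (𝒱 : Set (ℕ → Fin nx → ℝ)) (𝒲 : Set (ℕ → Fin ny → ℝ)),
        FSEstimation.AdmissibleRange 𝒱 → FSEstimation.AdmissibleRange 𝒲 →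
        ∀ l : ℝ, 0 < l →
          ∃ v ∈ 𝒱, ∃ w ∈ 𝒲, ∃ x₀ ∈ Metric.closedBall (0 : Fin nx → ℝ) l,
            ∃ z : ℕ → X, K.IsNoise z ∧ ∀ M : ℝ, ∃ t, M < ‖F.error P x₀ v w z t‖) :=
  have hgeneral := proposition3_general P K
  ⟨hgeneral.1 hobs, hgeneral.2⟩
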